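/- Let $n\ge 1$, let $k_1,\dots,k_n\ge 1$, let $\mathcal M=\{1^{k_1},2^{k_2},\dots,n^{k_n}\}$ be the multiset containing $i$ exactly $k_i$ times, and put $K=k_1+\cdots+k_n$. A permutation $\pi=\pi_1\cdots\pi_K$ of $\mathcal M$ is a Stirling permutation if $i<j<l$ and $\pi_i=\pi_l$ imply $\pi_j\ge\pi_i$; let $\mathcal Q_{\mathcal M}$ be the set of these. With the convention $\pi_0=\pi_{K+1}=0$, let $\mathrm{asc}(\pi)$, $\mathrm{des}(\pi)$, $\mathrm{plat}(\pi)$ be the numbers of indices $0\le i\le K$ with $\pi_i<\pi_{i+1}$, $\pi_i>\pi_{i+1}$, $\pi_i=\pi_{i+1}$, respectively, and let $$Q_{\mathcal M}(x,y,z)=\sum_{\pi\in\mathcal Q_{\mathcal M}}x^{\mathrm{asc}(\pi)}y^{\mathrm{des}(\pi)}z^{\mathrm{plat}(\pi)}.$$ A polynomial $h(x,y)$ is homogeneous $\gamma$-positive if, for some $d\ge 0$, $h(x,y)=\sum_{k=0}^{\lfloor d/2\rfloor}\gamma_k(xy)^k(x+y)^{d-2k}$ with all $\gamma_k\ge 0$.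 A polynomial $p(x,y,z)=\sum_i s_i(x,y)z^i$ is partial $\gamma$-positive if every $s_i$ is homogeneous $\gamma$-positive. Let $\mathcal T_{\mathcal M}$ be the set of ordered (plane rooted) trees whose vertices are labeled by the elements of the multiset $\{0\}\cup\mathcal M$, whose root is labeled $0$, and in which every vertex at odd level labeled $i$ has exactly $k_i-1$ children, all labeled $i$ (the level of a vertex is its distance from the root). Let $\mathcal{IT}_{\mathcal M}\subseteq\mathcal T_{\mathcal M}$ be the set of weakly increasing trees, i.e. those whose labels weakly increase along every path from the root to a leaf. To a vertex $u$ labeled $v_0$ with children labeled $v_1,\dots,v_\ell$ from left to right associate the word $v_0v_1\cdots v_\ell$, read cyclically. An entry of a cyclic word is a cyclic descent if it is greater than its successor, and a double cyclic descent if, moreover, it is smaller than its predecessor. Let $\mathrm{cdes}(T)$ be the sum over all vertices $u$ of $T$ of the number of cyclic descents of the word of $u$. Let $\mathrm{eleaf}(T)$ be the number of leaves at even level. Let $\mathrm{dcdes}(T)$ be the number of vertices that are double cyclic descents, where an even-level vertex is tested as the entry $v_0$ of its own word, and an odd-level vertex as the corresponding entry of the word of its parent. Then $Q_{\mathcal M}(x,y,z)$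 is partial $\gamma$-positive and has the expansion $$Q_{\mathcal M}(x,y,z)=\sum_{i=0}^{K-n}z^i\sum_{j=1}^{\lfloor (K+1-i)/2\rfloor}\gamma^{\mathcal{IT}}_{\mathcal M,i,j}\,(xy)^j(x+y)^{K+1-i-2j},$$ where $\gamma^{\mathcal{IT}}_{\mathcal M,i,j}=\bigl|\{T\in\mathcal{IT}_{\mathcal M}\mid \mathrm{cdes}(T)=j,\ \mathrm{eleaf}(T)=i,\ \mathrm{dcdes}(T)=0\}\bigr|$. -/

import Mathlib

namespace GammaPos

/-! ### Gamma-positivity -/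

/-- `h(x,y) = ∑_{k=0}^{⌊d/2⌋} γ_k (xy)^k (x+y)^{d-2k}` with all `γ_k ≥ 0`
(here `x = X 0`, `y = X 1`). -/
def HomGammaPositive (d : ℕ) (h : MvPolynomial (Fin 2) ℤ) : Prop :=
  ∃ γ : ℕ → ℤ, (∀ k, 0 ≤ γ k) ∧
    h = ∑ k ∈ Finset.range (d / 2 + 1),
      MvPolynomial.C (γ k) * (MvPolynomial.X 0 * MvPolynomial.X 1) ^ k *
        (MvPolynomial.X 0 + MvPolynomial.X 1) ^ (d - 2 * k)

/-- `p(x,y,z) = ∑_i s_i(x,y) z^i` (a finite sum) where every `s_i` is homogeneous gamma-positive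
(here `x = X 0`, `y = X 1`, `z = X 2`). -/
def PartialGammaPositive (p : MvPolynomial (Fin 3) ℤ) : Prop :=
  ∃ (N : ℕ) (s : ℕ → MvPolynomial (Fin 2) ℤ),
    (∀ i, ∃ d, HomGammaPositive d (s i)) ∧
    p = ∑ i ∈ Finset.range N,
      MvPolynomial.rename Fin.castSucc (s i) * MvPolynomial.X 2 ^ i

/-! ### Multisets and Stirling permutations -/

/-- The multiset `{1^{k_1}, 2^{k_2}, …, n^{k_n}}`. -/
def blockMultiset (n : ℕ) (k : ℕ → ℕ) : Multiset ℕ :=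
  ∑ i ∈ Finset.Icc 1 n, Multiset.replicate (k i) i

/-- A word is Stirling if every entry lying between two occurrences of a value `a`
is at least `a`. -/
def IsStirling (w : List ℕ) : Prop :=
  ∀ l < w.length, ∀ j < l, ∀ i < j, w.getD i 0 = w.getD l 0 → w.getD i 0 ≤ w.getD j 0

instance (w : List ℕ) : Decidable (IsStirling w) := by
  unfold IsStirling; infer_instance

/-- The finite set of Stirling permutations of the multiset `M`
(`M.lists` lists all the arrangements of `M` as a word). -/
def stirlingPerms (M : Multiset ℕ) : Finset (List ℕ) :=
  M.lists.toFinset.filter IsStirling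

/-- The entry `π_i` for `0 ≤ i ≤ m+1`, where `m` is the length of `π`, with the convention
`π_0 = π_{m+1} = 0`. -/
def entry (π : List ℕ) (i : ℕ) : ℕ := (0 :: π).getD i 0

/-- Number of ascents, i.e. of `0 ≤ i ≤ m` with `π_i < π_{i+1}`. -/
def asc (π : List ℕ) : ℕ :=
  ((Finset.range (π.length + 1)).filter fun i => entry π i < entry π (i + 1)).card

/-- Number of descents, i.e. of `0 ≤ i ≤ m` with `π_i > π_{i+1}`. -/
def des (π : List ℕ) : ℕ :=
  ((Finset.range (π.length + 1)).filter fun i => entry π i > entry π (i + 1)).card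

/-- Number of plateaux, i.e. of `0 ≤ i ≤ m` with `π_i = π_{i+1}`. -/
def plat (π : List ℕ) : ℕ :=
  ((Finset.range (π.length + 1)).filter fun i => entry π i = entry π (i + 1)).card

/-- `Q_M(x,y,z) = ∑_π x^{asc π} y^{des π} z^{plat π}` over the Stirling permutations of `M`. -/
noncomputable def stirlingPoly (M : Multiset ℕ) : MvPolynomial (Fin 3) ℤ :=
  ∑ π ∈ stirlingPerms M,
    MvPolynomial.X 0 ^ asc π * MvPolynomial.X 1 ^ des π * MvPolynomial.X 2 ^ plat π

/-! ### Cyclic statistics of words -/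

/-- The `i`-th entry (counted from `0`) of a word written on a cycle. -/
def cycEntry (w : List ℕ) (i : ℕ) : ℕ := w.getD (i % w.length) 0

/-- Number of cyclic descents of a word: entries greater than their cyclic successor. -/
def wordCdes (w : List ℕ) : ℕ :=
  ((Finset.range w.length).filter fun i => cycEntry w i > cycEntry w (i + 1)).card

/-- Number of double cyclic descents of a word: entries smaller than their cyclic predecessor
and greater than their cyclic successor. -/
def wordDcdes (w : List ℕ) : ℕ :=
  ((Finset.range w.length).filter fun i =>
    cycEntry w (i + w.length - 1) > cycEntry w i ∧ cycEntry w i > cycEntry w (i + 1)).card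

/-! ### Ordered labeled trees -/

/-- Ordered rooted trees with vertices labeled by natural numbers. -/
inductive OTree : Type
  | node (label : ℕ) (children : List OTree) : OTree

namespace OTree

/-- The label of the root. -/
def label : OTree → ℕ
  | node a _ => a

/-- The subtrees at the children of the root, from left to right. -/
def children : OTree → List OTree
  | node _ ts => ts

mutual
/-- All vertices of the tree, in preorder. A vertex is recorded as the pair consisting of its level
(the root being at level `d`) and the subtree consisting of it and its descendants. -/
def vertsFrom : ℕ → OTree → List (ℕ × OTree)
  | d, node a ts => (d, node a ts) :: vertsFromList (d + 1) ts
/-- The vertices of a list of trees whose roots are all at level `d`. -/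
def vertsFromList : ℕ → List OTree → List (ℕ × OTree)
  | _, [] => []
  | d, t :: ts => vertsFrom d t ++ vertsFromList d ts
end

/-- All vertices of a tree, with their levels; the root has level `0`. -/
def verts (T : OTree) : List (ℕ × OTree) := vertsFrom 0 T

/-- The multiset of the labels of all vertices. -/
def labels (T : OTree) : Multiset ℕ := (T.verts.map fun v => v.2.label : List ℕ)

/-- The word `v_0 v_1 … v_ℓ` of the root's label followed by the labels of its children. -/
def family (T : OTree) : List ℕ := T.label :: T.children.map label

/-- `cdes(T)`: the sum over all vertices `u` of the number of cyclic descents of the word of `u`. -/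
def cdes (T : OTree) : ℕ := (T.verts.map fun v => wordCdes v.2.family).sum

/-- `eleaf(T)`: the number of leaves at even level. -/
def eleaf (T : OTree) : ℕ := T.verts.countP fun v => Even v.1 ∧ v.2.children = []

/-- `dcdes(T)`: the number of vertices that are double cyclic descents. An even vertex is tested as
the first entry of its own word, an odd vertex as the corresponding entry of the word of its
(even) parent. Hence each vertex is exactly one entry of exactly one word of an even vertex, and
the number is the sum of the numbers of double cyclic descents of these words. -/
def dcdes (T : OTree) : ℕ :=
  ((T.verts.filter fun v => Even v.1).map fun v => wordDcdes v.2.family).sum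

/-- Membership in `𝒯_M`: the labels form the multiset `{0} ∪ M`, the root is labeled `0`, and an odd
vertex labeled `i` has exactly `k_i - 1` children, all labeled `i`, where `k_i` is the
multiplicity of `i` in `M`. -/
def IsQuasi (M : Multiset ℕ) (T : OTree) : Prop :=
  T.labels = 0 ::ₘ M ∧ T.label = 0 ∧
    ∀ v ∈ T.verts, Odd v.1 →
      v.2.children.length + 1 = M.count v.2.label ∧
      ∀ c ∈ v.2.children, c.label = v.2.label

/-- The labels weakly increase along every edge, going away from the root; equivalently, along every
path from the root to a leaf. -/
def IsWeaklyIncreasing (T : OTree) : Prop :=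
  ∀ v ∈ T.verts, ∀ c ∈ v.2.children, v.2.label ≤ c.label

end OTree

/-- The set `ℐ𝒯_M` of weakly increasing trees in `𝒯_M`. -/
def incTrees (M : Multiset ℕ) : Set OTree :=
  {T | T.IsQuasi M ∧ T.IsWeaklyIncreasing}

theorem mem_stirlingPerms (M : Multiset ℕ) (w : List ℕ) :
    w ∈ stirlingPerms M ↔ (w : Multiset ℕ) = M ∧ IsStirling w := by
  simp [stirlingPerms, Multiset.mem_lists_iff, eq_comm]

theorem map_vertsFrom_label (T : OTree) (d e : ℕ) :
    (OTree.vertsFrom d T).map (fun v => v.2.label) =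
      (OTree.vertsFrom e T).map (fun v => v.2.label) := by
  refine OTree.rec
    (motive_1 := fun T => ∀ d e : ℕ, (OTree.vertsFrom d T).map (fun v => v.2.label) =
      (OTree.vertsFrom e T).map (fun v => v.2.label))
    (motive_2 := fun ts => ∀ d e : ℕ, (OTree.vertsFromList d ts).map (fun v => v.2.label) =
      (OTree.vertsFromList e ts).map (fun v => v.2.label))
    ?_ ?_ ?_ T d e
  · intro a ts ih d e
    simp only [OTree.vertsFrom, List.map_cons, ih (d + 1) (e + 1)]
  · intro d e; simp [OTree.vertsFromList]
  · intro t ts h1 h2 d e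
    simp only [OTree.vertsFromList, List.map_append, h1 d e, h2 d e]

theorem labels_node (a : ℕ) (ts : List OTree) :
    (OTree.node a ts).labels = a ::ₘ (ts.map OTree.labels).sum := by
  have h : ∀ d, ((OTree.vertsFromList d ts).map (fun v => v.2.label) : Multiset ℕ) =
      (ts.map OTree.labels).sum := by
    intro d
    induction ts with
    | nil => simp [OTree.vertsFromList]
    | cons t ts ih =>
      simp only [OTree.vertsFromList, List.map_append, List.map_cons, List.sum_cons, ← ih,
        OTree.labels, OTree.verts, map_vertsFrom_label t d 0, Multiset.coe_add]
  simp only [OTree.labels, OTree.verts, OTree.vertsFrom, List.map_cons, ← Multiset.cons_coe]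
  rw [h]
  rfl

/-- There are finitely many trees with at most `m` vertices and labels at most `L`. -/
theorem finite_bounded (L m : ℕ) :
    {T : OTree | T.labels.card ≤ m ∧ ∀ a ∈ T.labels, a ≤ L}.Finite := by
  induction m with
  | zero =>
    refine Set.Finite.subset Set.finite_empty fun T hT => ?_
    obtain ⟨a, ts⟩ := T
    simp [labels_node] at hT
  | succ m ih =>
    set S := {T : OTree | T.labels.card ≤ m ∧ ∀ a ∈ T.labels, a ≤ L}
    have hS : Finite S := ih
    have hl := List.finite_length_le S m
    refine (((Set.finite_Iic L).prod hl).image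
      fun p => OTree.node p.1 (p.2.map Subtype.val)).subset ?_
    rintro ⟨a, ts⟩ ⟨h1, h2⟩
    rw [labels_node] at h1 h2
    simp only [Multiset.card_cons, Multiset.mem_cons] at h1 h2
    have hle : ∀ t ∈ ts, t.labels ≤ (ts.map OTree.labels).sum := fun t ht =>
      List.single_le_sum (fun _ _ => Multiset.zero_le _) _ (List.mem_map_of_mem ht)
    have hts : ∀ t ∈ ts, t ∈ S := fun t ht =>
      ⟨(Multiset.card_le_card (hle t ht)).trans (by omega),
        fun b hb => h2 b (Or.inr (Multiset.mem_of_le (hle t ht) hb))⟩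
    have hlen : ∀ us : List OTree, us.length ≤ (us.map OTree.labels).sum.card := by
      intro us
      induction us with
      | nil => simp
      | cons t us ihu =>
        obtain ⟨b, vs⟩ := t
        simp only [List.map_cons, List.sum_cons, Multiset.card_add, labels_node,
          Multiset.card_cons, List.length_cons]
        omega
    refine ⟨(a, ts.attach.map fun t => ⟨t.1, hts t.1 t.2⟩), ⟨h2 a (Or.inl rfl), ?_⟩, ?_⟩
    · have := hlen ts
      simp only [Set.mem_ofPred_eq, List.length_map, List.length_attach]
      omega
    · simp [List.map_map, Function.comp_def]

theorem incTrees_finite (M : Multiset ℕ) : (incTrees M).Finite := by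
  refine (finite_bounded M.sum (M.card + 1)).subset fun T hT => ?_
  have h : T.labels = 0 ::ₘ M := hT.1.1
  refine ⟨by simp [h], fun a ha => ?_⟩
  rw [h, Multiset.mem_cons] at ha
  rcases ha with rfl | ha
  · exact Nat.zero_le _
  · exact Multiset.single_le_sum (fun _ _ => Nat.zero_le _) a ha

/-- The number of `T ∈ ℐ𝒯_M` with `cdes(T) = j`, `eleaf(T) = i` and `dcdes(T) = 0`. (There are only
finitely many trees with a prescribed multiset of labels, see `incTrees_finite`.) -/
noncomputable def gammaIT (M : Multiset ℕ) (i j : ℕ) : ℕ :=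
  {T ∈ incTrees M | T.cdes = j ∧ T.eleaf = i ∧ T.dcdes = 0}.ncard

end GammaPos

-- Stirling permutations: inserting the block of the largest letter.

namespace GammaPos

-- Both sides are generated by one operator. Let D be the derivation with D x = D y = D z = xy. In a
-- Stirling permutation the copies of the largest letter m are contiguous, and deleting them leaves
-- a Stirling permutation of the smaller multiset. Inserting m^(c+1) into a gap of weight x, y or z
-- (ascent, descent, plateau) replaces this weight by x z^c y, so by the Leibniz rule a new largest
-- letter of multiplicity c+1 acts as z^c D (`sum_stirlingPerms_succ`).
--
-- In a weakly increasing tree the copies of the largest label form an odd vertex with c leaves,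
-- hung anywhere among the children of an even vertex (`mem_incTrees_succ`). In the cyclic words of
-- the even vertices give a peak the weight p, a double ascent q, a double descent r, a valley 1,
-- and a one-letter word z. A new maximum is itself a peak. In an ascent gap it turns the entry on
-- its right from a peak into a double descent, or from a double ascent into a valley; in a descent
-- gap it turns the entry on its left from a peak into a double ascent, or from a double descent
-- into a valley. This is the rule D p = p(q+r), D q = D r = D z = p, so the operator is again z^c D
-- (`sum_incTrees_succ`).
--
-- For p = xy and q + r = x + y the two rules are compatible, and the sums agree
-- (`sum_wordWt_eq_sum_wt`). Here q must be a separate variable, since D q = xy whereas D(x+y) =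
-- 2xy. Only afterwards is q set to x + y: then r = 0, the trees with a double cyclic descent
-- vanish, and `wt_eq` gives the exponents of the others.

theorem sum_eq_sum_insertions {α R : Type*} [AddCommMonoid R] [DecidableEq α]
    (S S' : Finset α) (ins : α → List α) (del : α → α) (f : α → R)
    (hnd : ∀ a ∈ S, (ins a).Nodup) (hdel : ∀ a ∈ S, ∀ b ∈ ins a, del b = a)
    (hmem : ∀ b, b ∈ S' ↔ ∃ a ∈ S, b ∈ ins a) :
    ∑ b ∈ S', f b = ∑ a ∈ S, ((ins a).map f).sum := by
  have h : S' = S.biUnion fun a => (ins a).toFinset := by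
    ext b; simp [hmem]
  rw [h, Finset.sum_biUnion]
  · exact Finset.sum_congr rfl fun a ha => List.sum_toFinset f (hnd a ha)
  · intro a ha b hb hab
    refine Finset.disjoint_left.2 fun c hc hc' => hab ?_
    rw [← hdel a ha c (List.mem_toFinset.1 hc), ← hdel b hb c (List.mem_toFinset.1 hc')]

/-! ### Block multisets -/

theorem blockMultiset_zero (k : ℕ → ℕ) : blockMultiset 0 k = 0 := by
  simp [blockMultiset]

theorem blockMultiset_succ (n : ℕ) (k : ℕ → ℕ) :
    blockMultiset (n + 1) k = blockMultiset n k + Multiset.replicate (k (n + 1)) (n + 1) := by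
  rw [blockMultiset, Finset.sum_Icc_succ_top (by omega), blockMultiset]

theorem count_blockMultiset (n : ℕ) (k : ℕ → ℕ) (i : ℕ) :
    (blockMultiset n k).count i = if i ∈ Finset.Icc 1 n then k i else 0 := by
  simp [blockMultiset, Multiset.count_sum', Multiset.count_replicate]

theorem mem_Icc_of_mem_blockMultiset {n : ℕ} {k : ℕ → ℕ} {i : ℕ} (h : i ∈ blockMultiset n k) :
    i ∈ Finset.Icc 1 n := by
  by_contra hi
  rw [← Multiset.count_pos, count_blockMultiset, if_neg hi] at h
  omega

theorem card_blockMultiset (n : ℕ) (k : ℕ → ℕ) :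
    (blockMultiset n k).card = ∑ i ∈ Finset.Icc 1 n, k i := by
  simp [blockMultiset]

/-! ### Stirling words and insertion of a block of maximal letters -/

/-- The subword form passes at once to subwords and through `filter`, which is how blocks are
removed below. -/
theorem isStirling_iff_sublist (w : List ℕ) :
    IsStirling w ↔ ∀ a b, List.Sublist [a, b, a] w → a ≤ b := by
  constructor
  · intro h a b hs
    obtain ⟨f, hf⟩ := List.sublist_iff_exists_orderEmbedding_getElem?_eq.1 hs
    have h0 := hf 0
    have h1 := hf 1
    have h2 := hf 2
    simp only [List.getElem?_cons_zero, List.getElem?_cons_succ] at h0 h1 h2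
    have hl : f 2 < w.length := (List.getElem?_eq_some_iff.1 h2.symm).1
    have := h (f 2) hl (f 1) (f.lt_iff_lt.2 (by norm_num)) (f 0) (f.lt_iff_lt.2 (by norm_num))
    simpa [List.getD_eq_getElem?_getD, ← h0, ← h1, ← h2] using this
  · intro h l hl j hj i hi hil
    refine h _ _ (List.sublist_iff_exists_fin_orderEmbedding_get_eq.2 ?_)
    have hj' : j < w.length := hj.trans hl
    have hi' : i < w.length := hi.trans hj'
    refine ⟨OrderEmbedding.ofStrictMono ![⟨i, hi'⟩, ⟨j, hj'⟩, ⟨l, hl⟩] ?_, ?_⟩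
    · intro s t hst
      fin_cases s <;> fin_cases t <;> first | (simp_all; done) | (simp_all; omega)
    · rw [List.getD_eq_getElem _ _ hi', List.getD_eq_getElem _ _ hl] at hil
      intro s
      fin_cases s
      · exact List.getD_eq_getElem _ _ hi'
      · exact List.getD_eq_getElem _ _ hj'
      · exact (List.getD_eq_getElem _ _ hi').trans hil

/-- All the words obtained by inserting the block `u` somewhere in a word. -/
def insertBlock (u : List ℕ) : List ℕ → List (List ℕ)
  | [] => [u]
  | a :: w => (u ++ a :: w) :: (insertBlock u w).map (a :: ·)

theorem mem_insertBlock {u w w' : List ℕ} :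
    w' ∈ insertBlock u w ↔ ∃ l₁ l₂, w = l₁ ++ l₂ ∧ w' = l₁ ++ (u ++ l₂) := by
  induction w generalizing w' with
  | nil =>
    simp only [insertBlock, List.mem_singleton, List.nil_eq, List.append_eq_nil_iff]
    constructor
    · rintro rfl; exact ⟨[], [], by simp⟩
    · rintro ⟨_, _, ⟨rfl, rfl⟩, rfl⟩; simp
  | cons a w ih =>
    simp only [insertBlock, List.mem_cons, List.mem_map, ih]
    constructor
    · rintro (rfl | ⟨_, ⟨l₁, l₂, rfl, rfl⟩, rfl⟩)
      · exact ⟨[], a :: w, by simp⟩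
      · exact ⟨a :: l₁, l₂, by simp⟩
    · rintro ⟨l₁, l₂, h, rfl⟩
      cases l₁ with
      | nil => left; simp_all
      | cons b l₁ =>
        simp only [List.cons_append, List.cons.injEq] at h
        obtain ⟨rfl, rfl⟩ := h
        exact Or.inr ⟨_, ⟨l₁, l₂, rfl, rfl⟩, rfl⟩

/-- As the block is nonempty, only insertion at the front gives a word starting with `m`. -/
theorem nodup_insertBlock {m c : ℕ} {w : List ℕ} (hw : m ∉ w) :
    (insertBlock (List.replicate (c + 1) m) w).Nodup := by
  induction w with
  | nil => simp [insertBlock]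
  | cons a w ih =>
    simp only [List.mem_cons, not_or] at hw
    simp only [insertBlock, List.nodup_cons, List.mem_map, not_exists, not_and]
    refine ⟨fun w' _ h => hw.1 ?_, (ih hw.2).map fun _ _ => by simp⟩
    simp [List.replicate_succ] at h
    exact h.1.symm

theorem filter_of_mem_insertBlock {m c : ℕ} {w w' : List ℕ} (hw : m ∉ w)
    (h : w' ∈ insertBlock (List.replicate c m) w) : w'.filter (· ≠ m) = w := by
  obtain ⟨l₁, l₂, rfl, rfl⟩ := mem_insertBlock.1 h
  simp only [List.mem_append, not_or] at hw
  have hf : ∀ l : List ℕ, m ∉ l → l.filter (· ≠ m) = l := fun l hl =>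
    List.filter_eq_self.2 fun a ha => by simpa using fun h : a = m => hl (h ▸ ha)
  rw [List.filter_append, List.filter_append, hf _ hw.1, hf _ hw.2]
  simp

theorem sublist_of_cons_sublist_append {a : ℕ} {l l₁ l₂ : List ℕ} (ha : a ∉ l₁)
    (h : List.Sublist (a :: l) (l₁ ++ l₂)) : List.Sublist (a :: l) l₂ := by
  induction l₁ with
  | nil => simpa using h
  | cons b l₁ ih =>
    simp only [List.mem_cons, not_or] at ha
    cases h with
    | cons _ h => exact ih ha.2 h
    | cons_cons _ h => exact absurd rfl ha.1

/-- Consider a subword `a b a` of the longer word. If `a = m`, it lies inside the block, so `b = m`;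
if `b = m`, maximality suffices; otherwise it survives the deletion of `m` and is a subword of `w`.
-/
theorem isStirling_of_mem_insertBlock {m c : ℕ} {w w' : List ℕ} (hw : ∀ a ∈ w, a < m)
    (h : w' ∈ insertBlock (List.replicate c m) w) : IsStirling w' ↔ IsStirling w := by
  have hm : m ∉ w := fun h => lt_irrefl _ (hw m h)
  have hf := filter_of_mem_insertBlock hm h
  obtain ⟨l₁, l₂, rfl, rfl⟩ := mem_insertBlock.1 h
  rw [isStirling_iff_sublist, isStirling_iff_sublist]
  constructor
  · intro hs a b hab
    exact hs a b (hab.trans ((List.Sublist.refl _).append (List.sublist_append_right _ _)))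
  · intro hs a b hab
    have hmem : ∀ x ∈ l₁ ++ (List.replicate c m ++ l₂), x ≤ m := by
      intro x hx
      simp only [List.mem_append, List.mem_replicate] at hx hw
      rcases hx with hx | hx | hx
      · exact (hw x (Or.inl hx)).le
      · exact hx.2.le
      · exact (hw x (Or.inr hx)).le
    simp only [List.mem_append, not_or] at hm
    by_cases ham : a = m
    · subst ham
      have h1 := sublist_of_cons_sublist_append hm.1 hab
      have h2 : List.Sublist [a, b, a] (List.replicate c a) := by
        -- The pattern is a palindrome, so reversal strips `l₂` just as `l₁` was stripped.
        rw [← List.reverse_sublist] at h1 ⊢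
        rw [List.reverse_append] at h1
        exact sublist_of_cons_sublist_append (by simpa using hm.2) h1
      exact (List.eq_of_mem_replicate (h2.subset (by simp : b ∈ [a, b, a]))).ge
    · by_cases hbm : b = m
      · exact hbm ▸ hmem a (hab.subset (by simp))
      · refine hs a b ?_
        have := hab.filter (· ≠ m)
        rw [hf] at this
        simpa [ham, hbm] using this

/-- If another `m` comes after the next letter `b`, then `m b m` is a subword, so `m ≤ b` and hence
`b = m` by maximality. -/
theorem exists_replicate_append_of_isStirling {m : ℕ} {w : List ℕ} (hs : IsStirling (m :: w))
    (hm : ∀ a ∈ w, a ≤ m) {c : ℕ} (hc : w.count m = c) :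
    ∃ l, m :: w = List.replicate (c + 1) m ++ l := by
  induction w generalizing c with
  | nil => simp at hc; subst hc; exact ⟨[], rfl⟩
  | cons b w ih =>
    rw [isStirling_iff_sublist] at hs
    cases c with
    | zero => exact ⟨b :: w, rfl⟩
    | succ c =>
      have hb : b = m := by
        by_contra hb
        rw [List.count_cons_of_ne (by simpa using hb)] at hc
        have hmw : m ∈ w := List.count_pos_iff.1 (by omega)
        have := hs m b (by simpa using hmw)
        exact hb (le_antisymm (hm b (by simp)) this)
      subst hb
      obtain ⟨l, hl⟩ := ih ((isStirling_iff_sublist _).2 fun x y hxy =>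
        hs x y (hxy.trans (List.sublist_cons_self _ _)))
        (fun a ha => hm a (by simp [ha])) (c := c) (by simpa using hc)
      exact ⟨l, by rw [hl, List.replicate_succ (n := c + 1)]; rfl⟩

theorem exists_mem_insertBlock_of_isStirling {m c : ℕ} {w : List ℕ} (hs : IsStirling w)
    (hm : ∀ a ∈ w, a ≤ m) (hc : w.count m = c + 1) :
    ∃ w₀, w ∈ insertBlock (List.replicate (c + 1) m) w₀ := by
  -- Split at the first occurrence of `m`, so that all copies lie in `m :: l₂`.
  obtain ⟨l₁, l₂, rfl, h⟩ := List.eq_append_cons_of_mem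
    (List.count_pos_iff.1 (by omega : 0 < w.count m))
  have hs' : IsStirling (m :: l₂) := (isStirling_iff_sublist _).2 fun a b hab =>
    (isStirling_iff_sublist _).1 hs a b (hab.trans (List.sublist_append_right _ _))
  rw [List.count_append, List.count_eq_zero_of_not_mem h, List.count_cons_self] at hc
  obtain ⟨l, hl⟩ := exists_replicate_append_of_isStirling hs' (fun a ha => hm a (by simp [ha]))
    (c := c) (by omega)
  exact ⟨l₁ ++ l, mem_insertBlock.2 ⟨l₁, l, rfl, by rw [hl]⟩⟩

theorem mem_stirlingPerms_blockMultiset_succ {n : ℕ} {k : ℕ → ℕ} {c : ℕ}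
    (hc : k (n + 1) = c + 1) (w : List ℕ) :
    w ∈ stirlingPerms (blockMultiset (n + 1) k) ↔
      ∃ w₀ ∈ stirlingPerms (blockMultiset n k),
        w ∈ insertBlock (List.replicate (c + 1) (n + 1)) w₀ := by
  have hlt : ∀ w₀ : List ℕ, (w₀ : Multiset ℕ) = blockMultiset n k → ∀ a ∈ w₀, a < n + 1 := by
    intro w₀ h a ha
    rw [← Multiset.mem_coe, h] at ha
    have := Finset.mem_Icc.1 (mem_Icc_of_mem_blockMultiset ha)
    omega
  have hcoe : ∀ w₀ : List ℕ, w ∈ insertBlock (List.replicate (c + 1) (n + 1)) w₀ →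
      (w : Multiset ℕ) = w₀ + Multiset.replicate (c + 1) (n + 1) := by
    intro w₀ h
    obtain ⟨l₁, l₂, rfl, rfl⟩ := mem_insertBlock.1 h
    rw [← Multiset.coe_add, ← Multiset.coe_add, ← Multiset.coe_add, Multiset.coe_replicate]
    abel
  simp only [mem_stirlingPerms, blockMultiset_succ, hc]
  constructor
  · rintro ⟨hw, hs⟩
    have hcount : w.count (n + 1) = c + 1 := by
      rw [← Multiset.coe_count, hw, Multiset.count_add, count_blockMultiset]
      simp
    obtain ⟨w₀, h₀⟩ := exists_mem_insertBlock_of_isStirling hs (fun a ha => by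
      rw [← Multiset.mem_coe, hw, Multiset.mem_add, Multiset.mem_replicate] at ha
      rcases ha with ha | ha
      · exact (Finset.mem_Icc.1 (mem_Icc_of_mem_blockMultiset ha)).2.trans (by omega)
      · exact ha.2.le) hcount
    have hw₀ : (w₀ : Multiset ℕ) = blockMultiset n k := by
      rw [hcoe w₀ h₀] at hw
      exact add_right_cancel hw
    exact ⟨w₀, ⟨hw₀, (isStirling_of_mem_insertBlock (hlt w₀ hw₀) h₀).1 hs⟩, h₀⟩
  · rintro ⟨w₀, ⟨hw₀, hs⟩, h₀⟩
    exact ⟨by rw [hcoe w₀ h₀, hw₀], (isStirling_of_mem_insertBlock (hlt w₀ hw₀) h₀).2 hs⟩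

/-! ### Weights of words -/

section Weight
variable {R : Type*} [CommRing R] (x y z : R)

/-- The weight of a pair of adjacent letters. -/
def pairWt (a b : ℕ) : R := if a < b then x else if b < a then y else z

/-- The product of the weights of the adjacent pairs of the word `a w 0`. -/
def wordWt : ℕ → List ℕ → R
  | a, [] => pairWt x y z a 0
  | a, b :: w => pairWt x y z a b * wordWt b w

theorem wordWt_replicate_append {m b : ℕ} (c : ℕ) (w : List ℕ) :
    wordWt x y z m (List.replicate c m ++ b :: w) =
      z ^ c * pairWt x y z m b * wordWt x y z b w := by
  induction c with
  | zero => simp [wordWt]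
  | succ c ih =>
    rw [List.replicate_succ, List.cons_append, wordWt, ih]
    simp only [pairWt, lt_irrefl, if_false]
    ring

theorem wordWt_replicate {m : ℕ} (c : ℕ) (hm : 0 < m) :
    wordWt x y z m (List.replicate c m) = z ^ c * y := by
  induction c with
  | zero => simp [wordWt, pairWt, hm]
  | succ c ih =>
    rw [List.replicate_succ, wordWt, ih]
    simp only [pairWt, lt_irrefl, if_false]
    ring

/-- Leibniz rule over the gaps of `a w 0`: whatever the weight of a gap, its derivative is `x * y`,
and inserting the block there replaces the weight by `x * z ^ c * y`. -/
theorem sum_wordWt_insertBlock (D : Derivation ℤ R R) (hx : D x = x * y) (hy : D y = x * y)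
    (hz : D z = x * y) {m : ℕ} (c : ℕ) (w : List ℕ) (hw : ∀ b ∈ w, b < m) (a : ℕ) (ha : a < m) :
    ((insertBlock (List.replicate (c + 1) m) w).map (wordWt x y z a)).sum =
      z ^ c * D (wordWt x y z a w) := by
  have hD : ∀ a b, D (pairWt x y z a b) = x * y := by
    intro a b; unfold pairWt; split_ifs <;> assumption
  have ham : pairWt x y z a m = x := if_pos ha
  induction w generalizing a with
  | nil =>
    simp only [insertBlock, List.map_cons, List.map_nil, List.sum_cons, List.sum_nil, wordWt, hD,
      List.replicate_succ, wordWt_replicate x y z c (by omega : 0 < m), ham]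
    ring
  | cons b w ih =>
    have hb : b < m := hw b (by simp)
    have hmb : pairWt x y z m b = y := by rw [pairWt, if_neg (by omega), if_pos hb]
    have := ih (fun b hb => hw b (by simp [hb])) b hb (if_pos hb)
    simp only [insertBlock, List.map_cons, List.map_map, List.sum_cons, wordWt, Derivation.leibniz,
      hD, List.replicate_succ, List.cons_append, wordWt_replicate_append, ham, hmb, smul_eq_mul,
      Function.comp_def, List.sum_map_mul_left]
    rw [← List.replicate_succ, this]
    ring

theorem wordWt_eq_pow (a : ℕ) (w : List ℕ) : wordWt x y z a w =
    x ^ ((Finset.range (w.length + 1)).filter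
        fun i => (a :: w).getD i 0 < (a :: w).getD (i + 1) 0).card *
      y ^ ((Finset.range (w.length + 1)).filter
        fun i => (a :: w).getD i 0 > (a :: w).getD (i + 1) 0).card *
      z ^ ((Finset.range (w.length + 1)).filter
        fun i => (a :: w).getD i 0 = (a :: w).getD (i + 1) 0).card := by
  have hp : ∀ a b, pairWt x y z a b = x ^ (if a < b then 1 else 0) * y ^ (if a > b then 1 else 0) *
      z ^ (if a = b then 1 else 0) := by
    intro a b
    unfold pairWt
    rcases lt_trichotomy a b with h | h | h
    · simp [h, h.not_gt, h.ne]
    · simp [h]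
    · simp [h, h.not_gt, h.ne']
  simp only [Finset.card_filter]
  induction w generalizing a with
  | nil => simp only [wordWt, hp, List.length_nil, zero_add, Finset.sum_range_one,
      List.getD_cons_zero, List.getD_cons_succ, List.getD_nil]
  | cons b w ih =>
    rw [wordWt, ih, hp, List.length_cons]
    simp only [Finset.sum_range_succ' _ (w.length + 1), List.getD_cons_succ, List.getD_cons_zero]
    ring

theorem wordWt_zero (w : List ℕ) :
    wordWt x y z 0 w = x ^ asc w * y ^ des w * z ^ plat w :=
  wordWt_eq_pow x y z 0 w

theorem sum_stirlingPerms_succ (D : Derivation ℤ R R) (hx : D x = x * y) (hy : D y = x * y)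
    (hz : D z = x * y) {n : ℕ} {k : ℕ → ℕ} {c : ℕ} (hc : k (n + 1) = c + 1) :
    ∑ w ∈ stirlingPerms (blockMultiset (n + 1) k), wordWt x y z 0 w =
      z ^ c * D (∑ w ∈ stirlingPerms (blockMultiset n k), wordWt x y z 0 w) := by
  have hlt : ∀ w ∈ stirlingPerms (blockMultiset n k), ∀ a ∈ w, a < n + 1 := by
    intro w hw a ha
    rw [← Multiset.mem_coe, ((mem_stirlingPerms _ _).1 hw).1] at ha
    have := Finset.mem_Icc.1 (mem_Icc_of_mem_blockMultiset ha)
    omega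
  have hnot : ∀ w ∈ stirlingPerms (blockMultiset n k), n + 1 ∉ w :=
    fun w hw h => lt_irrefl _ (hlt w hw _ h)
  rw [sum_eq_sum_insertions _ _ (insertBlock (List.replicate (c + 1) (n + 1)))
    (List.filter (· ≠ n + 1)) _ (fun w hw => nodup_insertBlock (hnot w hw))
    (fun w hw w' h => filter_of_mem_insertBlock (hnot w hw) h)
    (mem_stirlingPerms_blockMultiset_succ hc), map_sum, Finset.mul_sum]
  exact Finset.sum_congr rfl fun w hw =>
    sum_wordWt_insertBlock x y z D hx hy hz c w (hlt w hw) 0 (by omega)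

end Weight
end GammaPos

-- Weakly increasing trees: inserting the block of the largest label.

namespace GammaPos
namespace OTree

/-! ### Vertices of trees -/

theorem induction_children {P : OTree → Prop} (h : ∀ a ts, (∀ t ∈ ts, P t) → P (node a ts))
    (T : OTree) : P T :=
  OTree.rec (motive_1 := P) (motive_2 := fun ts => ∀ t ∈ ts, P t) h (by simp)
    (fun t ts h₁ h₂ s hs => by
      rcases List.mem_cons.1 hs with rfl | hs
      exacts [h₁, h₂ s hs]) T

@[simp] theorem label_node (a : ℕ) (ts : List OTree) : (node a ts).label = a := rfl

@[simp] theorem children_node (a : ℕ) (ts : List OTree) : (node a ts).children = ts := rfl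

theorem mem_vertsFromList {d : ℕ} {ts : List OTree} {v : ℕ × OTree} :
    v ∈ vertsFromList d ts ↔ ∃ t ∈ ts, v ∈ vertsFrom d t := by
  induction ts with
  | nil => simp [vertsFromList]
  | cons t ts ih => simp [vertsFromList, ih]

theorem label_mem_labels (T : OTree) : T.label ∈ T.labels := by
  cases T; simp [labels_node, label]

theorem labels_le_of_mem {t : OTree} {ts : List OTree} (h : t ∈ ts) :
    t.labels ≤ (ts.map labels).sum :=
  List.single_le_sum (fun _ _ => Multiset.zero_le _) _ (List.mem_map_of_mem h)

theorem mem_labels_node {a x : ℕ} {ts : List OTree} :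
    x ∈ (node a ts).labels ↔ x = a ∨ ∃ t ∈ ts, x ∈ t.labels := by
  simp only [labels_node, Multiset.mem_cons]
  refine or_congr_right ?_
  induction ts with
  | nil => simp
  | cons t ts ih => simp [ih]

theorem label_mem_labels_of_mem_vertsFrom {T : OTree} {d : ℕ} {v : ℕ × OTree}
    (h : v ∈ vertsFrom d T) : v.2.label ∈ T.labels := by
  induction T using induction_children generalizing d with
  | h a ts ih =>
    rw [vertsFrom, List.mem_cons, mem_vertsFromList] at h
    rw [mem_labels_node]
    rcases h with rfl | ⟨t, ht, h⟩
    · exact Or.inl rfl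
    · exact Or.inr ⟨t, ht, ih t ht h⟩

/-- All the vertices of the tree satisfy `p`, where the level of the root is `d`. -/
def AllVerts (p : ℕ → OTree → Prop) (d : ℕ) (T : OTree) : Prop :=
  ∀ v ∈ vertsFrom d T, p v.1 v.2

theorem allVerts_node {p : ℕ → OTree → Prop} {d a : ℕ} {ts : List OTree} :
    AllVerts p d (node a ts) ↔ p d (node a ts) ∧ ∀ t ∈ ts, AllVerts p (d + 1) t := by
  simp only [AllVerts, vertsFrom, List.mem_cons, forall_eq_or_imp, mem_vertsFromList]
  refine and_congr_right fun _ => ⟨fun h t ht v hv => h v ⟨t, ht, hv⟩, ?_⟩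
  rintro h v ⟨t, ht, hv⟩
  exact h t ht v hv

/-! ### Insertion of a block of maximal labels -/

/-- A vertex labeled `m` with `c` children, which are leaves labeled `m`. -/
def block (m c : ℕ) : OTree := node m (List.replicate c (node m []))

theorem labels_block (m c : ℕ) : (block m c).labels = Multiset.replicate (c + 1) m := by
  simp [block, labels_node, Multiset.nsmul_singleton, Multiset.replicate_succ]

mutual
/-- All the trees obtained from a tree with root at level `d` by inserting `B` as a new child of
a vertex at even level. -/
def insertions (B : OTree) : ℕ → OTree → List OTree
  | d, node a ts => (insertionsList B (d + 1) ts).map (node a)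
/-- The same for a list of trees whose roots are consecutive children of a vertex at level
`d - 1`. -/
def insertionsList (B : OTree) : ℕ → List OTree → List (List OTree)
  | d, [] => if Odd d then [[B]] else []
  | d, t :: ts => (if Odd d then [B :: t :: ts] else []) ++
      (insertions B d t).map (· :: ts) ++ (insertionsList B d ts).map (t :: ·)
end

variable {B : OTree} {d : ℕ}

theorem mem_insertions_node {a : ℕ} {ts : List OTree} {T' : OTree} :
    T' ∈ insertions B d (node a ts) ↔ ∃ ts' ∈ insertionsList B (d + 1) ts, node a ts' = T' := by
  simp [insertions]

theorem mem_insertionsList_nil {ts' : List OTree} :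
    ts' ∈ insertionsList B d [] ↔ Odd d ∧ ts' = [B] := by
  rw [insertionsList]; split_ifs with h <;> simp [h]

theorem mem_insertionsList_cons {t : OTree} {ts ts' : List OTree} :
    ts' ∈ insertionsList B d (t :: ts) ↔ (Odd d ∧ ts' = B :: t :: ts) ∨
      (∃ t' ∈ insertions B d t, ts' = t' :: ts) ∨
      ∃ us ∈ insertionsList B d ts, ts' = t :: us := by
  rw [insertionsList]; split_ifs with h <;> simp [h, eq_comm]

theorem label_of_mem_insertions {T T' : OTree} (h : T' ∈ insertions B d T) :
    T'.label = T.label := by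
  cases T
  obtain ⟨_, _, rfl⟩ := mem_insertions_node.1 h
  rfl

theorem labels_of_mem_insertionsList {ts ts' : List OTree}
    (ih : ∀ t ∈ ts, ∀ t' ∈ insertions B d t, t'.labels = t.labels + B.labels)
    (h : ts' ∈ insertionsList B d ts) :
    (ts'.map labels).sum = (ts.map labels).sum + B.labels := by
  induction ts generalizing ts' with
  | nil =>
    obtain ⟨-, rfl⟩ := mem_insertionsList_nil.1 h
    simp
  | cons t ts ihl =>
    rcases mem_insertionsList_cons.1 h with ⟨-, rfl⟩ | ⟨t', ht', rfl⟩ | ⟨us, hus, rfl⟩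
    · simp only [List.map_cons, List.sum_cons]; abel
    · simp only [List.map_cons, List.sum_cons, ih t (by simp) t' ht']; abel
    · simp only [List.map_cons, List.sum_cons, ihl (fun t ht => ih t (by simp [ht])) hus]; abel

theorem labels_of_mem_insertions {T T' : OTree} (h : T' ∈ insertions B d T) :
    T'.labels = T.labels + B.labels := by
  induction T using induction_children generalizing d T' with
  | h a ts ih =>
    obtain ⟨ts', h', rfl⟩ := mem_insertions_node.1 h
    clear h
    rw [labels_node, labels_node, labels_of_mem_insertionsList (fun t ht t' ht' => ih t ht ht') h',
      Multiset.cons_add]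

/-- In a list `t :: ts` the three kinds of insertion differ in their heads: `B`, a modified `t`, or
`t` itself. The label `m`, absent from `t`, tells them apart. -/
theorem nodup_insertions {m : ℕ} (hB : B.label = m) {T : OTree} (hT : m ∉ T.labels) (d : ℕ) :
    (insertions B d T).Nodup := by
  induction T using induction_children generalizing d with
  | h a ts ih =>
    simp only [mem_labels_node, not_or, not_exists, not_and] at hT
    rw [insertions]
    refine List.Nodup.map (fun _ _ => by simp) ?_
    generalize d + 1 = d
    replace ih : ∀ t ∈ ts, (insertions B d t).Nodup := fun t ht => ih t ht (hT.2 t ht) d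
    replace hT := hT.2
    induction ts with
    | nil => rw [insertionsList]; split_ifs <;> simp
    | cons t ts ihl =>
      have h₁ := ihl (fun t ht => ih t (by simp [ht])) (fun t ht => hT t (by simp [ht]))
      have h₂ := ih t (by simp)
      have ht : m ∉ t.labels := hT t (by simp)
      have hBt : B ≠ t := fun h => ht (h ▸ hB ▸ label_mem_labels B)
      have hmB : m ∈ B.labels := hB ▸ label_mem_labels B
      have ht' : ∀ t' ∈ insertions B d t, t' ≠ t := by
        rintro t' h rfl
        exact ht (labels_of_mem_insertions h ▸ Multiset.mem_add.2 (Or.inr hmB))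
      have hBt' : B ∉ insertions B d t := fun h =>
        ht (hB ▸ label_of_mem_insertions h ▸ label_mem_labels t)
      rw [insertionsList, List.append_assoc, List.nodup_append']
      refine ⟨by split_ifs <;> simp, ?_, ?_⟩
      · rw [List.nodup_append']
        refine ⟨h₂.map fun _ _ => by simp, h₁.map fun _ _ => by simp, ?_⟩
        simp only [List.disjoint_left, List.mem_map]
        rintro _ ⟨t', h, rfl⟩ ⟨us, -, h'⟩
        exact ht' t' h (List.cons.inj h').1.symm
      · split_ifs
        · simp only [List.disjoint_left, List.mem_singleton, forall_eq,
            List.mem_append, List.mem_map, not_or, not_exists, not_and, List.cons.injEq]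
          exact ⟨fun t' h e _ => hBt' (e ▸ h), fun us _ e _ => hBt e.symm⟩
        · simp

mutual
/-- Delete all the non-root vertices labeled `m` (with their descendants). -/
def del (m : ℕ) : OTree → OTree
  | node a ts => node a (delList m ts)
/-- Delete all the vertices labeled `m` (with their descendants). -/
def delList (m : ℕ) : List OTree → List OTree
  | [] => []
  | t :: ts => if t.label = m then delList m ts else del m t :: delList m ts
end

theorem delList_eq_self {m : ℕ} {ts : List OTree} (ih : ∀ t ∈ ts, del m t = t)
    (hts : ∀ t ∈ ts, m ∉ t.labels) : delList m ts = ts := by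
  induction ts with
  | nil => rfl
  | cons t ts ihl =>
    have : t.label ≠ m := fun h => hts t (by simp) (h ▸ label_mem_labels t)
    rw [delList, if_neg this, ih t (by simp),
      ihl (fun t ht => ih t (by simp [ht])) (fun t ht => hts t (by simp [ht]))]

theorem del_eq_self {m : ℕ} {T : OTree} (hT : m ∉ T.labels) : del m T = T := by
  induction T using induction_children with
  | h a ts ih =>
    simp only [mem_labels_node, not_or, not_exists, not_and] at hT
    rw [del, delList_eq_self (fun t ht => ih t ht (hT.2 t ht)) hT.2]

theorem del_of_mem_insertions {m : ℕ} (hB : B.label = m) {T T' : OTree} (hT : m ∉ T.labels)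
    (h : T' ∈ insertions B d T) : del m T' = T := by
  induction T using induction_children generalizing d T' with
  | h a ts ih =>
    simp only [mem_labels_node, not_or, not_exists, not_and] at hT
    obtain ⟨ts', h', rfl⟩ := mem_insertions_node.1 h
    clear h
    rw [del]
    congr 1
    revert h'
    generalize d + 1 = d
    replace ih : ∀ t ∈ ts, ∀ t' ∈ insertions B d t, del m t' = t :=
      fun t ht t' h => ih t ht (hT.2 t ht) h
    replace hT := hT.2
    intro h
    induction ts generalizing ts' with
    | nil =>
      obtain ⟨-, rfl⟩ := mem_insertionsList_nil.1 h
      simp [delList, hB]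
    | cons t ts ihl =>
      have hl : t.label ≠ m := fun h => hT t (by simp) (h ▸ label_mem_labels t)
      have hd : ∀ us : List OTree, (∀ t ∈ us, m ∉ t.labels) → delList m us = us := fun us hus =>
        delList_eq_self (fun t ht => del_eq_self (hus t ht)) hus
      rcases mem_insertionsList_cons.1 h with ⟨-, rfl⟩ | ⟨t', ht', rfl⟩ | ⟨us, hus, rfl⟩
      · rw [delList, if_pos hB, hd _ hT]
      · rw [delList, label_of_mem_insertions ht', if_neg hl, ih t (by simp) t' ht',
          hd _ fun t ht => hT t (by simp [ht])]
      · rw [delList, if_neg hl, del_eq_self (hT t (by simp)),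
          ihl us (fun t ht => ih t (by simp [ht])) (fun t ht => hT t (by simp [ht])) hus]

/-! ### Local conditions and insertion -/

/-- The condition on a vertex of a weakly increasing tree in `𝒯_M`, where `κ i` is the
multiplicity of `i`. -/
def Regular (κ : ℕ → ℕ) (d : ℕ) (T : OTree) : Prop :=
  (Odd d → T.children.length + 1 = κ T.label ∧ ∀ c ∈ T.children, c.label = T.label) ∧
    ∀ c ∈ T.children, T.label ≤ c.label

/-- The labels of the children of a vertex at even level are distinct and greater than the
label of the vertex, those of the children of a vertex at odd level agree with the label of the
vertex. -/
def Separated (d : ℕ) (T : OTree) : Prop :=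
  (Odd d → ∀ c ∈ T.children, c.label = T.label) ∧
    (Even d → (T.children.map label).Nodup ∧ ∀ c ∈ T.children, T.label < c.label)

theorem map_label_of_mem_insertionsList {ts ts' : List OTree} (hd : ¬ Odd d)
    (h : ts' ∈ insertionsList B d ts) : ts'.map label = ts.map label := by
  induction ts generalizing ts' with
  | nil => exact absurd (mem_insertionsList_nil.1 h).1 hd
  | cons t ts ihl =>
    rcases mem_insertionsList_cons.1 h with ⟨h, -⟩ | ⟨t', ht', rfl⟩ | ⟨us, hus, rfl⟩
    · exact absurd h hd
    · simp [label_of_mem_insertions ht']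
    · simp [ihl hus]

theorem map_label_of_mem_insertionsList_or {ts ts' : List OTree}
    (h : ts' ∈ insertionsList B d ts) :
    (ts'.map label : Multiset ℕ) = ts.map label ∨
      (ts'.map label : Multiset ℕ) = B.label ::ₘ (ts.map label : Multiset ℕ) := by
  induction ts generalizing ts' with
  | nil =>
    obtain ⟨-, rfl⟩ := mem_insertionsList_nil.1 h
    simp
  | cons t ts ihl =>
    rcases mem_insertionsList_cons.1 h with ⟨-, rfl⟩ | ⟨t', ht', rfl⟩ | ⟨us, hus, rfl⟩
    · simp
    · simp [label_of_mem_insertions ht']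
    · simp only [List.map_cons, ← Multiset.cons_coe]
      rcases ihl hus with h | h
      · exact Or.inl (by rw [h])
      · exact Or.inr (by rw [h, Multiset.cons_swap])

theorem forall_label_of_mem_insertionsList {ts ts' : List OTree} {q : ℕ → Prop} (hq : q B.label)
    (h : ts' ∈ insertionsList B d ts) : (∀ c ∈ ts', q c.label) ↔ ∀ c ∈ ts, q c.label := by
  have key : ∀ us : List OTree, (∀ c ∈ us, q c.label) ↔ ∀ a ∈ (us.map label : Multiset ℕ), q a := by
    intro us; simp
  rw [key, key]
  rcases map_label_of_mem_insertionsList_or h with h | h <;> simp [h, hq]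

/-- Transfers a local condition `p` in both directions: `p` must hold throughout `B`, and at an old
vertex it must not notice the change of the list of children. -/
theorem allVerts_of_mem_insertions {p : ℕ → OTree → Prop} {m : ℕ}
    (hB : ∀ d, Odd d → AllVerts p d B)
    (hp : ∀ d a ts ts', a < m → ts' ∈ insertionsList B (d + 1) ts →
      (∀ t ∈ ts, t.label < m) → (p d (node a ts') ↔ p d (node a ts)))
    {T T' : OTree} (hT : ∀ a ∈ T.labels, a < m) (h : T' ∈ insertions B d T) :
    AllVerts p d T' ↔ AllVerts p d T := by
  induction T using induction_children generalizing d T' with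
  | h a ts ih =>
    simp only [mem_labels_node] at hT
    obtain ⟨ts', h', rfl⟩ := mem_insertions_node.1 h
    clear h
    rw [allVerts_node, allVerts_node, hp d a ts ts' (hT a (Or.inl rfl)) h'
      fun t ht => hT _ (Or.inr ⟨t, ht, label_mem_labels t⟩)]
    refine and_congr_right fun hpd => ?_
    clear hpd hp
    revert h'
    generalize d + 1 = d
    replace ih : ∀ t ∈ ts, ∀ t' ∈ insertions B d t, AllVerts p d t' ↔ AllVerts p d t :=
      fun t ht t' h => ih t ht (fun a ha => hT a (Or.inr ⟨t, ht, ha⟩)) h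
    intro h
    clear hT
    induction ts generalizing ts' with
    | nil =>
      obtain ⟨hd, rfl⟩ := mem_insertionsList_nil.1 h
      simp [hB d hd]
    | cons t ts ihl =>
      rcases mem_insertionsList_cons.1 h with ⟨hd, rfl⟩ | ⟨t', ht', rfl⟩ | ⟨us, hus, rfl⟩
      · simp [hB d hd]
      · simp [ih t (by simp) t' ht']
      · simp [ihl us (fun t ht => ih t (by simp [ht])) hus]

theorem regular_of_mem_insertions {κ : ℕ → ℕ} {m c : ℕ} (hc : κ m = c + 1) {T T' : OTree}
    (hT : ∀ a ∈ T.labels, a < m) (h : T' ∈ insertions (block m c) d T) :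
    AllVerts (Regular κ) d T' ↔ AllVerts (Regular κ) d T := by
  refine allVerts_of_mem_insertions (fun d hd => ?_) (fun d a ts ts' ha h _ => ?_) hT h
  · rw [block, allVerts_node]
    refine ⟨⟨fun _ => ⟨by simp [hc], ?_⟩, ?_⟩, ?_⟩
    · intro c hc; rw [List.eq_of_mem_replicate hc]; rfl
    · intro c hc; rw [List.eq_of_mem_replicate hc]; rfl
    · intro t ht
      rw [List.eq_of_mem_replicate ht, allVerts_node]
      refine ⟨⟨fun h => absurd hd (by simpa [Nat.odd_add_one] using h), ?_⟩, ?_⟩ <;>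
        simp
  · simp only [Regular, children_node, label_node]
    refine and_congr (imp_congr_right fun hd => ?_)
      (forall_label_of_mem_insertionsList (q := fun b => a ≤ b) (by simpa [block] using ha.le) h)
    have hl := map_label_of_mem_insertionsList (by simpa [Nat.odd_add_one] using hd) h
    have key : ∀ us : List OTree, (us.length + 1 = κ a ∧ ∀ c ∈ us, c.label = a) ↔
        ((us.map label).length + 1 = κ a ∧ ∀ b ∈ us.map label, b = a) := by
      intro us; simp
    rw [key, key, hl]

theorem separated_of_mem_insertions {m c : ℕ} {T T' : OTree}
    (hT : ∀ a ∈ T.labels, a < m) (h : T' ∈ insertions (block m c) d T) :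
    AllVerts Separated d T' ↔ AllVerts Separated d T := by
  refine allVerts_of_mem_insertions (fun d hd => ?_) (fun d a ts ts' ha h hts => ?_) hT h
  · rw [block, allVerts_node]
    refine ⟨⟨fun _ => ?_, fun h => absurd hd (by simpa using h)⟩, ?_⟩
    · intro c hc; rw [List.eq_of_mem_replicate hc]; rfl
    · intro t ht
      rw [List.eq_of_mem_replicate ht, allVerts_node]
      refine ⟨⟨fun h => absurd hd (by simpa [Nat.odd_add_one] using h), ?_⟩, ?_⟩ <;>
        simp
  · simp only [Separated, children_node, label_node]
    refine and_congr (imp_congr_right fun hd => ?_) (imp_congr_right fun _ => and_congr ?_ ?_)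
    · have hl := map_label_of_mem_insertionsList (by simpa [Nat.odd_add_one] using hd) h
      have key : ∀ us : List OTree, (∀ c ∈ us, c.label = a) ↔ ∀ b ∈ us.map label, b = a := by
        intro us; simp
      rw [key, key, hl]
    · rw [← Multiset.coe_nodup, ← Multiset.coe_nodup]
      rcases map_label_of_mem_insertionsList_or h with h | h <;> rw [h]
      rw [Multiset.nodup_cons, and_iff_right]
      rw [Multiset.mem_coe, List.mem_map]
      rintro ⟨t, ht, h⟩
      exact (hts t ht).ne h
    · exact forall_label_of_mem_insertionsList (q := fun b => a < b) (by simpa [block] using ha) h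

/-! ### Every regular tree arises by insertion -/

/-- A topmost vertex labeled `m` is at odd level, since a non-root even vertex copies the label of
its parent; being regular, it brings `κ m - 1` children labeled `m`. Hence the copies of `m` cannot
be shared between sibling subtrees. -/
theorem le_count_labels {κ : ℕ → ℕ} {m : ℕ} {T : OTree} (hT : AllVerts (Regular κ) d T)
    (hl : Even d → T.label ≠ m) : T.labels.count m = 0 ∨ κ m ≤ T.labels.count m := by
  induction T using induction_children generalizing d with
  | h a ts ih =>
    obtain ⟨hr, hts⟩ := allVerts_node.1 hT
    simp only [Regular, children_node, label_node] at hr hl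
    by_cases ham : a = m
    · have hd : Odd d := by
        by_contra hd
        exact hl (Nat.not_odd_iff_even.1 hd) ham
      right
      subst ham
      rw [labels_node, Multiset.count_cons_self, ← (hr.1 hd).1]
      have := (hr.1 hd).2
      gcongr
      clear * - this
      induction ts with
      | nil => simp
      | cons t ts ih =>
        have := ih fun c hc => this c (by simp [hc])
        have ht : 0 < t.labels.count a :=
          Multiset.count_pos.2 (‹∀ c ∈ t :: ts, c.label = a› t (by simp) ▸ label_mem_labels t)
        simp only [List.length_cons, List.map_cons, List.sum_cons, Multiset.count_add]
        omega
    · have hts' : ∀ t ∈ ts, t.labels.count m = 0 ∨ κ m ≤ t.labels.count m := by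
        intro t ht
        refine ih t ht (hts t ht) fun hd => ?_
        rw [(hr.1 (by simpa [Nat.even_add_one] using hd)).2 t ht]
        exact ham
      rw [labels_node, Multiset.count_cons_of_ne (Ne.symm ham)]
      clear * - hts'
      induction ts with
      | nil => simp
      | cons t ts ih =>
        have h₁ := ih fun t ht => hts' t (by simp [ht])
        have h₂ := hts' t (by simp)
        simp only [List.map_cons, List.sum_cons, Multiset.count_add]
        omega

/-- The root and its `c` children already use all `c + 1` copies of `m`. A grandchild would be
labeled at least `m`, hence exactly `m` by maximality, and would be one copy too many. -/
theorem eq_block {κ : ℕ → ℕ} {m c : ℕ} (hc : κ m = c + 1) {T : OTree}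
    (hT : AllVerts (Regular κ) d T) (hd : Odd d) (hl : T.label = m) (hle : ∀ a ∈ T.labels, a ≤ m)
    (hcount : T.labels.count m = c + 1) : T = block m c := by
  obtain ⟨a, ts⟩ := T
  simp only [label_node] at hl
  subst hl
  obtain ⟨hr, hts⟩ := allVerts_node.1 hT
  simp only [Regular, children_node, label_node] at hr
  obtain ⟨hlen, hlab⟩ := hr.1 hd
  have hlen' : ts.length = c := by omega
  rw [labels_node, Multiset.count_cons_self, ← hlen', Nat.add_right_cancel_iff] at hcount
  simp only [mem_labels_node] at hle
  have h₁ : ∀ t ∈ ts, t.labels.count a = 1 := by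
    clear * - hcount hlab
    have hpos : ∀ t ∈ ts, 0 < t.labels.count a :=
      fun t ht => Multiset.count_pos.2 (hlab t ht ▸ label_mem_labels t)
    clear hlab
    have hge : ∀ us : List OTree, (∀ t ∈ us, 0 < t.labels.count a) →
        us.length ≤ (us.map labels).sum.count a := by
      intro us hus
      induction us with
      | nil => simp
      | cons t us ih =>
        have h₁ := ih fun t ht => hus t (by simp [ht])
        have h₂ := hus t (by simp)
        simp only [List.length_cons, List.map_cons, List.sum_cons, Multiset.count_add]
        omega
    induction ts with
    | nil => simp
    | cons t ts ih =>
      have h₁ := hge ts fun t ht => hpos t (by simp [ht])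
      have h₂ := hpos t (by simp)
      simp only [List.length_cons, List.map_cons, List.sum_cons, Multiset.count_add] at hcount
      intro s hs
      rcases List.mem_cons.1 hs with rfl | hs
      · omega
      · exact ih (by omega) (fun t ht => hpos t (by simp [ht])) s hs
  have h₂ : ∀ t ∈ ts, t = node a [] := by
    intro t ht
    obtain ⟨b, us⟩ := t
    obtain rfl : b = a := hlab _ ht
    congr 1
    refine List.eq_nil_iff_forall_not_mem.2 fun u hu => ?_
    have hub : u.label = b := by
      refine le_antisymm (hle _ (Or.inr ⟨_, ht, ?_⟩)) ((allVerts_node.1 (hts _ ht)).1.2 u hu)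
      exact mem_labels_node.2 (Or.inr ⟨u, hu, label_mem_labels u⟩)
    have h₃ := h₁ _ ht
    rw [labels_node, Multiset.count_cons_self, Nat.add_eq_right, Multiset.count_eq_zero] at h₃
    exact h₃ (Multiset.mem_of_le (labels_le_of_mem hu) (hub ▸ label_mem_labels u))
  rw [block, List.eq_replicate_iff.2 ⟨hlen', h₂⟩]

/-- Descend into the one child subtree that contains all the copies of `m`, until its root is
labeled `m`; this root is at odd level, and `eq_block` applies. -/
theorem exists_mem_insertions {κ : ℕ → ℕ} {m c : ℕ} (hc : κ m = c + 1) {T : OTree}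
    (hT : AllVerts (Regular κ) d T) (hl : T.label ≠ m) (hle : ∀ a ∈ T.labels, a ≤ m)
    (hcount : T.labels.count m = c + 1) : ∃ T₀, T ∈ insertions (block m c) d T₀ := by
  induction T using induction_children generalizing d with
  | h a ts ih =>
    obtain ⟨hr, hts⟩ := allVerts_node.1 hT
    simp only [Regular, children_node, label_node] at hr hl
    rw [labels_node, Multiset.count_cons_of_ne (Ne.symm hl)] at hcount
    simp only [mem_labels_node] at hle
    replace hle : ∀ t ∈ ts, ∀ b ∈ t.labels, b ≤ m := fun t ht b hb => hle b (Or.inr ⟨t, ht, hb⟩)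
    have hne : Even (d + 1) → ∀ t ∈ ts, t.label ≠ m := fun hd t ht => by
      rw [(hr.1 (by simpa [Nat.even_add_one] using hd)).2 t ht]
      exact hl
    suffices ∃ ts₀, ts ∈ insertionsList (block m c) (d + 1) ts₀ by
      obtain ⟨ts₀, h⟩ := this
      exact ⟨node a ts₀, mem_insertions_node.2 ⟨ts, h, rfl⟩⟩
    clear hr hT
    revert hts hne
    generalize d + 1 = d
    intro hts hne
    induction ts with
    | nil => simp at hcount
    | cons t ts ihl =>
      have ht := le_count_labels (hts t (by simp)) (m := m) fun hd => hne hd t (by simp)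
      rw [hc] at ht
      simp only [List.map_cons, List.sum_cons, Multiset.count_add] at hcount
      rcases ht with ht | ht
      · obtain ⟨us, hus⟩ := ihl (fun t ht => ih t (by simp [ht])) (by omega)
          (fun t ht => hle t (by simp [ht])) (fun t ht => hts t (by simp [ht]))
          (fun hd t ht => hne hd t (by simp [ht]))
        exact ⟨t :: us, mem_insertionsList_cons.2 (Or.inr (Or.inr ⟨ts, hus, rfl⟩))⟩
      · by_cases htm : t.label = m
        · have hd : Odd d := by
            by_contra hd
            exact hne (Nat.not_odd_iff_even.1 hd) t (by simp) htm
          obtain rfl := eq_block hc (hts t (by simp)) hd htm (hle t (by simp)) (by omega)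
          refine ⟨ts, ?_⟩
          cases ts with
          | nil => exact mem_insertionsList_nil.2 ⟨hd, rfl⟩
          | cons s ts => exact mem_insertionsList_cons.2 (Or.inl ⟨hd, rfl⟩)
        · obtain ⟨t₀, ht₀⟩ := ih t (by simp) (hts t (by simp)) htm (hle t (by simp)) (by omega)
          exact ⟨t₀ :: ts, mem_insertionsList_cons.2 (Or.inr (Or.inl ⟨t, ht₀, rfl⟩))⟩

end OTree

/-! ### The trees of a block multiset -/

open OTree

theorem mem_incTrees_blockMultiset {n : ℕ} {k : ℕ → ℕ} {T : OTree} :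
    T ∈ incTrees (blockMultiset n k) ↔ T.labels = 0 ::ₘ blockMultiset n k ∧ T.label = 0 ∧
      AllVerts (Regular k) 0 T := by
  constructor
  · rintro ⟨⟨h₁, h₂, h₃⟩, h₄⟩
    refine ⟨h₁, h₂, fun v hv => ⟨fun hd => ?_, h₄ v hv⟩⟩
    obtain ⟨h₅, h₆⟩ := h₃ v hv hd
    rw [count_blockMultiset] at h₅
    -- Outside `1, …, n` the multiplicity is 0, which cannot equal a successor.
    split_ifs at h₅
    exact ⟨h₅, h₆⟩
  · rintro ⟨h₁, h₂, h₃⟩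
    refine ⟨⟨h₁, h₂, fun v hv hd => ?_⟩, fun v hv => (h₃ v hv).2⟩
    obtain ⟨h₅, h₆⟩ := (h₃ v hv).1 hd
    refine ⟨?_, h₆⟩
    rw [count_blockMultiset, if_pos, h₅]
    obtain ⟨a, ts⟩ := T
    obtain rfl : a = 0 := h₂
    rw [verts, vertsFrom, List.mem_cons, mem_vertsFromList] at hv
    rcases hv with rfl | ⟨t, ht, hv⟩
    · simp at hd
    · rw [labels_node] at h₁
      have := Multiset.mem_of_le (labels_le_of_mem ht) (label_mem_labels_of_mem_vertsFrom hv)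
      rw [(Multiset.cons_inj_right 0).1 h₁] at this
      exact mem_Icc_of_mem_blockMultiset this

theorem lt_of_mem_labels {n : ℕ} {k : ℕ → ℕ} {T : OTree} (hT : T ∈ incTrees (blockMultiset n k)) :
    ∀ a ∈ T.labels, a < n + 1 := by
  intro a ha
  rw [(mem_incTrees_blockMultiset.1 hT).1, Multiset.mem_cons] at ha
  rcases ha with rfl | ha
  · omega
  · have := Finset.mem_Icc.1 (mem_Icc_of_mem_blockMultiset ha)
    omega

theorem mem_incTrees_succ {n : ℕ} {k : ℕ → ℕ} {c : ℕ} (hc : k (n + 1) = c + 1) (T : OTree) :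
    T ∈ incTrees (blockMultiset (n + 1) k) ↔
      ∃ T₀ ∈ incTrees (blockMultiset n k), T ∈ insertions (block (n + 1) c) 0 T₀ := by
  constructor
  · intro h
    obtain ⟨h₁, h₂, h₃⟩ := mem_incTrees_blockMultiset.1 h
    have hcount : T.labels.count (n + 1) = c + 1 := by
      rw [h₁, Multiset.count_cons_of_ne (by omega), count_blockMultiset, if_pos (by simp), hc]
    obtain ⟨T₀, h₀⟩ := exists_mem_insertions hc h₃ (by omega)
      (fun a ha => Nat.lt_succ_iff.1 (lt_of_mem_labels h a ha)) hcount
    have hlab : T₀.labels = 0 ::ₘ blockMultiset n k := by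
      have := labels_of_mem_insertions h₀
      rw [h₁, labels_block, blockMultiset_succ, hc, ← Multiset.cons_add] at this
      exact (add_right_cancel this).symm
    refine ⟨T₀, mem_incTrees_blockMultiset.2 ⟨hlab, ?_, ?_⟩, h₀⟩
    · rw [← label_of_mem_insertions h₀, h₂]
    · refine (regular_of_mem_insertions hc ?_ h₀).1 h₃
      intro a ha
      rw [hlab, Multiset.mem_cons] at ha
      rcases ha with rfl | ha
      · omega
      · have := Finset.mem_Icc.1 (mem_Icc_of_mem_blockMultiset ha)
        omega
  · rintro ⟨T₀, h₀, h⟩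
    obtain ⟨h₁, h₂, h₃⟩ := mem_incTrees_blockMultiset.1 h₀
    refine mem_incTrees_blockMultiset.2 ⟨?_, ?_, ?_⟩
    · rw [labels_of_mem_insertions h, h₁, labels_block, blockMultiset_succ, hc, Multiset.cons_add]
    · rw [label_of_mem_insertions h, h₂]
    · exact (regular_of_mem_insertions hc (lt_of_mem_labels h₀) h).2 h₃

theorem incTrees_blockMultiset_zero (k : ℕ → ℕ) : incTrees (blockMultiset 0 k) = {node 0 []} := by
  ext ⟨a, ts⟩
  rw [mem_incTrees_blockMultiset, Set.mem_singleton_iff, labels_node, blockMultiset_zero,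
    label_node]
  constructor
  · rintro ⟨h, rfl, -⟩
    congr
    refine List.eq_nil_iff_forall_not_mem.2 fun t ht => ?_
    have := Multiset.mem_of_le (labels_le_of_mem ht) (label_mem_labels t)
    simp [(Multiset.cons_inj_right 0).1 h] at this
  · intro h
    cases h
    simp [allVerts_node, Regular]

/-- Distinctness of siblings under an even vertex is not part of the definition of the trees: it
holds because each label enters as the root of a single block. It excludes ties in the cyclic words
of the even vertices. -/
theorem separated_of_mem_incTrees {n : ℕ} {k : ℕ → ℕ} (hk : ∀ i ∈ Finset.Icc 1 n, 1 ≤ k i)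
    {T : OTree} (hT : T ∈ incTrees (blockMultiset n k)) : AllVerts Separated 0 T := by
  induction n generalizing T with
  | zero =>
    rw [incTrees_blockMultiset_zero, Set.mem_singleton_iff] at hT
    subst hT
    simp [allVerts_node, Separated]
  | succ n ih =>
    have hc : k (n + 1) = k (n + 1) - 1 + 1 := by
      have := hk (n + 1) (by simp)
      omega
    obtain ⟨T₀, h₀, h⟩ := (mem_incTrees_succ hc T).1 hT
    refine (separated_of_mem_insertions (lt_of_mem_labels h₀) h).2 (ih (fun i hi => hk i ?_) h₀)
    simp only [Finset.mem_Icc] at hi ⊢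
    omega

end GammaPos

-- The derivation acting on tree weights.

namespace GammaPos
namespace OTree

/-! ### Weights of trees -/

section Weight
variable {R : Type*} [CommRing R] (p q r z : R)

/-- The weight of an entry of a word: `s` says whether the entry is greater than its predecessor,
`t` whether it is smaller than its successor. -/
def entryWt (s t : Bool) : R :=
  if s then (if t then q else p) else (if t then 1 else r)

/-- The product of the weights of the entries of the word `a w`, where `s` says whether `a`
is greater than its predecessor, and the last entry is greater than its successor. -/
def chainWt : Bool → ℕ → List ℕ → R
  | s, _, [] => entryWt p q r s false
  | s, a, b :: w => entryWt p q r s (a < b) * chainWt (a < b) b w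

/-- The weight of the cyclic word `a w` of a vertex at even level. -/
def familyWt (a : ℕ) (w : List ℕ) : R := if w = [] then z else chainWt p q r false a w

mutual
/-- The product of the weights of the words of the vertices at even level. -/
def wt : ℕ → OTree → R
  | d, node a ts => (if Even d then familyWt p q r z a (ts.map label) else 1) * wtList (d + 1) ts
/-- The product of the weights of a list of trees with roots at level `d`. -/
def wtList : ℕ → List OTree → R
  | _, [] => 1
  | d, t :: ts => wt d t * wtList d ts
end

theorem wt_block {m c d : ℕ} (hd : Odd d) : wt p q r z d (block m c) = z ^ c := by
  rw [block, wt, if_neg (Nat.not_even_iff_odd.2 hd), one_mul]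
  induction c with
  | zero => simp [wtList]
  | succ c ih =>
    rw [List.replicate_succ, wtList, ih, wt, if_pos (by simpa [Nat.even_add_one] using hd)]
    simp [familyWt, wtList, pow_succ']

variable {p q r z} (D : Derivation ℤ R R)

theorem sum_wtList_insertionsList_even {B : OTree} {ζ : R} {d : ℕ} (hd : ¬ Odd d)
    {ts : List OTree}
    (ih : ∀ t ∈ ts, ((insertions B d t).map (wt p q r z d)).sum = ζ * D (wt p q r z d t)) :
    ((insertionsList B d ts).map (wtList p q r z d)).sum = ζ * D (wtList p q r z d ts) := by
  induction ts with
  | nil => simp [insertionsList, hd, wtList]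
  | cons t ts ihl =>
    have h := ihl fun t ht => ih t (by simp [ht])
    have ht := ih t (by simp)
    simp only [insertionsList, if_neg hd, List.nil_append, List.map_append, List.map_map,
      List.sum_append, Function.comp_def, wtList, List.sum_map_mul_left, List.sum_map_mul_right,
      h, ht, Derivation.leibniz, smul_eq_mul]
    ring

/-- Each gap is charged to one neighbouring entry: an ascent gap to its right end, a descent gap to
its left end. If `s` holds, the gap in front of `a` is charged to `a` but is not among the
insertions; filling it would add a peak and make `a` smaller than its predecessor. The subtracted
term is this contribution. -/
theorem sum_chainWt_insertionsList (hp : D p = p * (q + r)) (hq : D q = p) (hr : D r = p)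
    {m c : ℕ} {d : ℕ} (hd : Odd d) {ts : List OTree} (hts : ∀ t ∈ ts, t.label < m)
    (ih : ∀ t ∈ ts, ((insertions (block m c) d t).map (wt p q r z d)).sum =
      z ^ c * D (wt p q r z d t)) (s : Bool) (a : ℕ) (ha : a < m) :
    ((insertionsList (block m c) d ts).map fun ts' =>
        chainWt p q r s a (ts'.map label) * wtList p q r z d ts').sum =
      z ^ c * (D (chainWt p q r s a (ts.map label) * wtList p q r z d ts) -
        if s then p * (chainWt p q r false a (ts.map label) * wtList p q r z d ts) else 0) := by
  induction ts generalizing s a with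
  | nil =>
    have hm : (block m c).label = m := rfl
    cases s <;> simp [insertionsList, hd, wtList, chainWt, wt_block p q r z hd, hm, ha, entryWt,
      hp, hr] <;> ring
  | cons t ts ihl =>
    have hm : (block m c).label = m := rfl
    have htm : ¬ m < t.label := (hts t (by simp)).not_gt
    have h := ihl (fun t ht => hts t (by simp [ht])) (fun t ht => ih t (by simp [ht]))
      (decide (a < t.label)) t.label (hts t (by simp))
    have ht := ih t (by simp)
    have h₁ : ((insertions (block m c) d t).map fun t' =>
        entryWt p q r s (a < t'.label) * chainWt p q r (a < t'.label) t'.label (ts.map label) *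
          (wt p q r z d t' * wtList p q r z d ts)).sum =
        entryWt p q r s (a < t.label) * chainWt p q r (a < t.label) t.label (ts.map label) *
          (z ^ c * D (wt p q r z d t) * wtList p q r z d ts) := by
      rw [← ht, ← List.sum_map_mul_right, ← List.sum_map_mul_left]
      refine congrArg List.sum (List.map_congr_left fun t' ht' => ?_)
      rw [label_of_mem_insertions ht']
    have h₂ : ((insertionsList (block m c) d ts).map fun us =>
        entryWt p q r s (a < t.label) * chainWt p q r (a < t.label) t.label (us.map label) *
          (wt p q r z d t * wtList p q r z d us)).sum =
        entryWt p q r s (a < t.label) * wt p q r z d t *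
          ((insertionsList (block m c) d ts).map fun us =>
            chainWt p q r (a < t.label) t.label (us.map label) * wtList p q r z d us).sum := by
      rw [← List.sum_map_mul_left]
      refine congrArg List.sum (List.map_congr_left fun t' ht' => ?_)
      ring
    simp only [insertionsList, if_pos hd, List.map_append, List.map_map, List.map_cons,
      List.map_nil, List.sum_append, List.sum_cons, List.sum_nil, Function.comp_def, wtList,
      chainWt, hm, wt_block p q r z hd, h₁, h₂, h, htm, ha, decide_true, decide_false]
    have hqr : D (q + r) = 2 * p := by rw [map_add, hq, hr]; ring
    by_cases hat : a < t.label <;> cases s <;>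
      simp [hat, entryWt, Derivation.leibniz, hp, hq, hr] <;> ring

theorem sum_wt_insertions (hp : D p = p * (q + r)) (hq : D q = p) (hr : D r = p) (hz : D z = p)
    {m c : ℕ} {T : OTree} (hT : ∀ a ∈ T.labels, a < m) (d : ℕ) :
    ((insertions (block m c) d T).map (wt p q r z d)).sum = z ^ c * D (wt p q r z d T) := by
  induction T using induction_children generalizing d with
  | h a ts ih =>
    simp only [mem_labels_node] at hT
    have ha := hT a (Or.inl rfl)
    have hts : ∀ t ∈ ts, t.label < m := fun t ht => hT _ (Or.inr ⟨t, ht, label_mem_labels t⟩)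
    replace ih := fun t ht => ih t ht (fun b hb => hT b (Or.inr ⟨t, ht, hb⟩)) (d + 1)
    simp only [insertions, List.map_map, Function.comp_def, wt]
    by_cases hd : Even d
    · have hd' : Odd (d + 1) := by simpa [Nat.odd_add_one] using hd
      simp only [if_pos hd]
      cases ts with
      | nil =>
        have hm : (block m c).label = m := rfl
        simp [insertionsList, hd', familyWt, wtList, wt_block p q r z hd', chainWt, hm, ha,
          entryWt, hz, mul_comm]
      | cons t ts =>
        -- No correction arises for `s = false`: cyclically, the gap before the first entry is the
        -- gap after the last one, which is already counted.
        have := sum_chainWt_insertionsList D hp hq hr hd' hts ih false a ha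
        simp only [Bool.false_eq_true, if_false, sub_zero] at this
        rw [familyWt, if_neg (by simp), ← this]
        refine congrArg List.sum (List.map_congr_left fun ts' h => ?_)
        rw [familyWt, if_neg]
        intro h'
        rw [List.map_eq_nil_iff] at h'
        subst h'
        rcases mem_insertionsList_cons.1 h with ⟨-, h⟩ | ⟨_, _, h⟩ | ⟨_, _, h⟩ <;> simp at h
    · simp only [if_neg hd, one_mul]
      exact sum_wtList_insertionsList_even D (by simpa [Nat.odd_add_one] using hd) ih

theorem sum_incTrees_succ (hp : D p = p * (q + r)) (hq : D q = p) (hr : D r = p) (hz : D z = p)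
    {n : ℕ} {k : ℕ → ℕ} {c : ℕ} (hc : k (n + 1) = c + 1) :
    ∑ T ∈ (incTrees_finite (blockMultiset (n + 1) k)).toFinset, wt p q r z 0 T =
      z ^ c * D (∑ T ∈ (incTrees_finite (blockMultiset n k)).toFinset, wt p q r z 0 T) := by
  classical
  have hnot : ∀ T ∈ incTrees (blockMultiset n k), n + 1 ∉ T.labels :=
    fun T hT h => lt_irrefl _ (lt_of_mem_labels hT _ h)
  rw [sum_eq_sum_insertions (incTrees_finite (blockMultiset n k)).toFinset _
    (insertions (block (n + 1) c) 0) (del (n + 1)) _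
    (fun T hT => nodup_insertions rfl (hnot T (by simpa using hT)) 0)
    (fun T hT T' h => del_of_mem_insertions rfl (hnot T (by simpa using hT)) h)
    (by simpa using mem_incTrees_succ hc), map_sum, Finset.mul_sum]
  exact Finset.sum_congr rfl fun T hT =>
    sum_wt_insertions D hp hq hr hz (lt_of_mem_labels (by simpa using hT)) 0

end Weight
end OTree

open OTree in
-- Both sides start from `z` (empty word, single root) and obey the same recursion, because D(xy) =
-- xy(x + y) and D(x + y - q) = xy.
theorem sum_wordWt_eq_sum_wt {R : Type*} [CommRing R] (D : Derivation ℤ R R) {x y z q : R}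
    (hx : D x = x * y) (hy : D y = x * y) (hz : D z = x * y) (hq : D q = x * y)
    (n : ℕ) (k : ℕ → ℕ) (hk : ∀ i ∈ Finset.Icc 1 n, 1 ≤ k i) :
    ∑ w ∈ stirlingPerms (blockMultiset n k), wordWt x y z 0 w =
      ∑ T ∈ (incTrees_finite (blockMultiset n k)).toFinset, wt (x * y) q (x + y - q) z 0 T := by
  induction n with
  | zero =>
    have h₁ : stirlingPerms (blockMultiset 0 k) = {[]} := by
      ext w
      rw [mem_stirlingPerms, blockMultiset_zero, Finset.mem_singleton]
      constructor
      · rintro ⟨h, -⟩; simpa using h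
      · rintro rfl; simp [IsStirling]
    have h₂ : (incTrees_finite (blockMultiset 0 k)).toFinset = {node 0 []} := by
      ext T; simp [incTrees_blockMultiset_zero]
    simp [h₁, h₂, wordWt, pairWt, wt, wtList, familyWt]
  | succ n ih =>
    have hc : k (n + 1) = k (n + 1) - 1 + 1 := by
      have := hk (n + 1) (by simp)
      omega
    rw [sum_stirlingPerms_succ x y z D hx hy hz hc, ih fun i hi => hk i (by
      simp only [Finset.mem_Icc] at hi ⊢; omega),
      sum_incTrees_succ D (by simp [Derivation.leibniz, hx, hy]; ring) hq
      (by rw [map_sub, map_add, hx, hy, hq]; ring) hz hc]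

end GammaPos

-- From weights to the statistics of trees.

namespace GammaPos

/-! ### Cyclic statistics of words -/

theorem wordCdes_eq_zero {a : ℕ} {w : List ℕ} (h : ∀ b ∈ w, b = a) : wordCdes (a :: w) = 0 := by
  have hc : ∀ i, cycEntry (a :: w) i = a := by
    intro i
    have hi : i % (a :: w).length < (a :: w).length := Nat.mod_lt _ (by simp)
    rw [cycEntry, List.getD_eq_getElem _ _ hi]
    rcases List.mem_cons.1 (List.getElem_mem hi) with h' | h'
    exacts [h', h _ h']
  simp [wordCdes, hc]

/-- The default value `a` encodes the wrap-around: the index just past the last entry returns to the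
first. -/
theorem cycEntry_cons {a : ℕ} {w : List ℕ} {i : ℕ} (hi : i ≤ w.length + 1) :
    cycEntry (a :: w) i = (a :: w).getD i a := by
  rcases hi.lt_or_eq with hi | rfl
  · have hi' : i < (a :: w).length := by simpa using hi
    rw [cycEntry, Nat.mod_eq_of_lt hi', List.getD_eq_getElem _ _ hi', List.getD_eq_getElem _ _ hi']
  · rw [cycEntry, List.getD_eq_default (d := a) _ (by simp)]
    simp

theorem one_le_wordCdes {a : ℕ} {w : List ℕ} (h : ∀ b ∈ w, a < b) (hw : w ≠ []) :
    1 ≤ wordCdes (a :: w) := by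
  refine Finset.card_pos.2 ⟨w.length, Finset.mem_filter.2 ⟨by simp, ?_⟩⟩
  rw [cycEntry_cons (Nat.le_succ _), cycEntry_cons le_rfl,
    List.getD_eq_default (a :: w) (n := w.length + 1) a (by simp),
    List.getD_eq_getElem _ _ (by simp),
    List.getElem_cons_length rfl, List.getLast_cons hw]
  exact h _ (List.getLast_mem hw)

theorem wordCdes_cons_cons {a b : ℕ} {w : List ℕ} (hab : a < b) :
    wordCdes (a :: b :: w) = ∑ i ∈ Finset.range (w.length + 1),
      if (b :: w).getD i a > (b :: w).getD (i + 1) a then 1 else 0 := by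
  rw [wordCdes, Finset.card_filter, List.length_cons, List.length_cons, Finset.sum_range_succ']
  have h₀ : ¬ cycEntry (a :: b :: w) 0 > cycEntry (a :: b :: w) (0 + 1) := by
    rw [cycEntry_cons (by simp), cycEntry_cons (by simp)]
    simpa using hab.le
  rw [if_neg h₀, add_zero]
  refine Finset.sum_congr rfl fun i hi => ?_
  have := Finset.mem_range.1 hi
  rw [cycEntry_cons (by simp; omega), cycEntry_cons (by simp; omega), List.getD_cons_succ,
    List.getD_cons_succ]

theorem wordDcdes_cons_cons {a b : ℕ} {w : List ℕ} (hab : a < b) :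
    wordDcdes (a :: b :: w) = ∑ i ∈ Finset.range (w.length + 1),
      if (a :: b :: w).getD i a > (b :: w).getD i a ∧ (b :: w).getD i a > (b :: w).getD (i + 1) a
      then 1 else 0 := by
  rw [wordDcdes, Finset.card_filter, List.length_cons, List.length_cons, Finset.sum_range_succ']
  have h₀ : ¬ cycEntry (a :: b :: w) 0 > cycEntry (a :: b :: w) (0 + 1) := by
    rw [cycEntry_cons (by simp), cycEntry_cons (by simp)]
    simpa using hab.le
  rw [if_neg fun h => h₀ h.2, add_zero]
  refine Finset.sum_congr rfl fun i hi => ?_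
  have := Finset.mem_range.1 hi
  have h₁ : cycEntry (a :: b :: w) (i + 1 + (w.length + 1 + 1) - 1) = cycEntry (a :: b :: w) i := by
    rw [show i + 1 + (w.length + 1 + 1) - 1 = i + (w.length + 1 + 1) by omega]
    simp [cycEntry]
  rw [h₁, cycEntry_cons (by simp; omega), cycEntry_cons (by simp; omega),
    cycEntry_cons (by simp; omega), List.getD_cons_succ, List.getD_cons_succ]

namespace OTree

section Monomial
variable {R : Type*} [CommRing R] (p q r z : R)

/-- Here `x` is the predecessor of `a`, and `e`, below all entries, follows the last one. Descents
are peaks or double descents. The word ends with a descent, so peaks outnumber valleys by one if it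
begins with an ascent from `x`, and equal them in number otherwise; this accounts for the constants
2 and 1. -/
theorem chainWt_eq {e : ℕ} {w : List ℕ} {x a : ℕ} (ha : e < a) (hw : ∀ b ∈ w, e < b)
    (hnd : (a :: w).Nodup) (hx : x ≠ a) {s t : ℕ}
    (hs : s = ∑ i ∈ Finset.range (w.length + 1),
      if (a :: w).getD i e > (a :: w).getD (i + 1) e then 1 else 0)
    (ht : t = ∑ i ∈ Finset.range (w.length + 1),
      if (x :: a :: w).getD i e > (a :: w).getD i e ∧ (a :: w).getD i e > (a :: w).getD (i + 1) e
      then 1 else 0) :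
    ∃ P E, P + t = s ∧ E + t + 2 * P = w.length + (if x < a then 2 else 1) ∧
      chainWt p q r (x < a) a w = p ^ P * q ^ E * r ^ t := by
  induction w generalizing x a s t with
  | nil =>
    simp only [List.length_nil, zero_add, Finset.sum_range_one, List.getD_cons_zero,
      List.getD_cons_succ, List.getD_nil, gt_iff_lt, ha, if_true, and_true] at hs ht
    subst hs ht
    rcases hx.lt_or_gt with hx | hx
    · exact ⟨1, 0, by simp [hx, hx.not_gt, chainWt, entryWt]⟩
    · exact ⟨0, 0, by simp [hx.not_gt, hx, chainWt, entryWt]⟩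
  | cons b w ih =>
    rw [List.length_cons, Finset.sum_range_succ'] at hs ht
    simp only [List.getD_cons_succ, List.getD_cons_zero] at hs ht
    have hab : a ≠ b := by rintro rfl; simp at hnd
    obtain ⟨P, E, h₁, h₂, h₃⟩ := ih (x := a) (a := b) (hw b (by simp))
      (fun c hc => hw c (by simp [hc])) hnd.of_cons hab rfl rfl
    simp only [List.getD_cons_succ] at h₁ h₂ h₃
    simp only [chainWt, h₃]
    rw [← h₁] at hs
    clear h₃ h₁ ih
    revert hs ht h₂
    generalize (∑ i ∈ Finset.range (w.length + 1), _ : ℕ) = t'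
    intro ht hs h₂
    rcases hx.lt_or_gt with hx | hx <;> rcases hab.lt_or_gt with hab | hab <;>
      simp only [hx, hab, hx.not_gt, hab.not_gt, if_true, if_false, and_true, and_false, and_self,
        decide_true, decide_false, entryWt, List.length_cons,
        Bool.false_eq_true] at hs ht h₂ ⊢
    · exact ⟨P, E + 1, by omega, by omega, by rw [ht]; ring⟩
    · exact ⟨P + 1, E, by omega, by omega, by rw [ht]; ring⟩
    · exact ⟨P, E, by omega, by omega, by rw [ht]; ring⟩
    · exact ⟨P, E, by omega, by omega, by rw [ht]; ring⟩

theorem familyWt_eq {a : ℕ} {w : List ℕ} (hnd : w.Nodup) (hw : ∀ b ∈ w, a < b) :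
    ∃ P E, P + wordDcdes (a :: w) = wordCdes (a :: w) ∧
      E + wordDcdes (a :: w) + 2 * P + (if w = [] then 1 else 0) = w.length + 1 ∧
      familyWt p q r z a w =
        p ^ P * q ^ E * r ^ wordDcdes (a :: w) * z ^ (if w = [] then 1 else 0) := by
  cases w with
  | nil =>
    have h₁ : wordCdes [a] = 0 := wordCdes_eq_zero (by simp)
    have h₂ : wordDcdes [a] = 0 := by simp [wordDcdes, cycEntry]
    exact ⟨0, 0, by simp [h₁, h₂, familyWt]⟩
  | cons b w =>
    have hab := hw b (by simp)
    obtain ⟨P, E, h₁, h₂, h₃⟩ := chainWt_eq p q r hab (fun c hc => hw c (by simp [hc])) hnd hab.ne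
      (wordCdes_cons_cons hab) (wordDcdes_cons_cons hab)
    rw [if_pos hab] at h₂
    refine ⟨P, E, h₁, by simp; omega, ?_⟩
    simp only [hab, decide_true] at h₃
    simp [familyWt, chainWt, hab, h₃, entryWt]

/-- The sum of the values of `f` at all the vertices, where the root is at level `d`. -/
def sumVerts (f : ℕ → OTree → ℕ) (d : ℕ) (T : OTree) : ℕ :=
  ((vertsFrom d T).map fun v => f v.1 v.2).sum

theorem sumVerts_node (f : ℕ → OTree → ℕ) (d a : ℕ) (ts : List OTree) :
    sumVerts f d (node a ts) = f d (node a ts) + (ts.map (sumVerts f (d + 1))).sum := by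
  rw [sumVerts, vertsFrom, List.map_cons, List.sum_cons]
  congr 1
  generalize d + 1 = d
  induction ts with
  | nil => simp [vertsFromList]
  | cons t ts ih => simp [vertsFromList, ih, sumVerts]

/-- The number of cyclic descents of the word of a vertex. -/
def cdesVert (_ : ℕ) (T : OTree) : ℕ := wordCdes T.family

/-- The number of double cyclic descents of the word of a vertex at even level. -/
def dcdesVert (d : ℕ) (T : OTree) : ℕ := if Even d then wordDcdes T.family else 0

/-- The indicator function of the leaves at even level. -/
def eleafVert (d : ℕ) (T : OTree) : ℕ := if Even d ∧ T.children = [] then 1 else 0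

theorem cdes_eq_sumVerts (T : OTree) : T.cdes = sumVerts cdesVert 0 T := rfl

theorem dcdes_eq_sumVerts (T : OTree) : T.dcdes = sumVerts dcdesVert 0 T := by
  rw [dcdes, sumVerts, verts]
  induction vertsFrom 0 T with
  | nil => rfl
  | cons v l ih =>
    rw [List.filter_cons]
    split_ifs with h <;> simp at h <;> simp [dcdesVert, h, ih]

theorem eleaf_eq_sumVerts (T : OTree) : T.eleaf = sumVerts eleafVert 0 T := by
  rw [eleaf, sumVerts, verts]
  induction vertsFrom 0 T with
  | nil => rfl
  | cons v l ih =>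
    rw [List.countP_cons, ih, List.map_cons, List.sum_cons, add_comm]
    congr 1
    simp [eleafVert]

/-- Peaks and valleys of a cyclic word are equally many, so 2P plus the double ascents and double
descents is its length; a one-letter word counts as a leaf instead. Every vertex is an entry of one
word of an even vertex; for a root at odd level that word belongs to its parent, whence the extra 1.
-/
theorem wt_eq {d : ℕ} {T : OTree} (hT : AllVerts Separated d T) :
    ∃ P E, P + sumVerts dcdesVert d T = sumVerts cdesVert d T ∧
      E + sumVerts dcdesVert d T + 2 * P + sumVerts eleafVert d T + (if Even d then 0 else 1) =
        T.labels.card ∧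
      wt p q r z d T =
        p ^ P * q ^ E * r ^ sumVerts dcdesVert d T * z ^ sumVerts eleafVert d T := by
  induction T using induction_children generalizing d with
  | h a ts ih =>
    obtain ⟨hs, hts⟩ := allVerts_node.1 hT
    replace ih := fun t ht => ih t ht (hts t ht)
    simp only [Separated, children_node, label_node] at hs
    have hl : ∃ P E, P + (ts.map (sumVerts dcdesVert (d + 1))).sum =
          (ts.map (sumVerts cdesVert (d + 1))).sum ∧
        E + (ts.map (sumVerts dcdesVert (d + 1))).sum + 2 * P +
          (ts.map (sumVerts eleafVert (d + 1))).sum + (if Even (d + 1) then 0 else ts.length) =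
          (ts.map labels).sum.card ∧
        wtList p q r z (d + 1) ts = p ^ P * q ^ E * r ^ (ts.map (sumVerts dcdesVert (d + 1))).sum *
          z ^ (ts.map (sumVerts eleafVert (d + 1))).sum := by
      clear hs hts hT
      revert ih
      generalize d + 1 = d
      intro ih
      induction ts with
      | nil => exact ⟨0, 0, by simp [wtList]⟩
      | cons t ts ihl =>
        obtain ⟨P, E, h₁, h₂, h₃⟩ := ihl fun t ht => ih t (by simp [ht])
        obtain ⟨P', E', h₁', h₂', h₃'⟩ := ih t (by simp)
        simp only [List.map_cons, List.sum_cons, List.length_cons, Multiset.card_add]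
        refine ⟨P' + P, E' + E, by omega, by split_ifs at * <;> omega, ?_⟩
        rw [wtList, h₃, h₃']
        ring
    obtain ⟨P, E, h₁, h₂, h₃⟩ := hl
    simp only [sumVerts_node, labels_node, Multiset.card_cons, wt, h₃]
    by_cases hd : Even d
    · obtain ⟨hnd, hlt⟩ := hs.2 hd
      obtain ⟨P', E', h₁', h₂', h₃'⟩ := familyWt_eq p q r z hnd (a := a) (by simpa using hlt)
      have hf : (node a ts).family = a :: ts.map label := rfl
      have hd' : ¬ Even (d + 1) := by simpa [Nat.even_add_one] using hd
      simp only [cdesVert, dcdesVert, eleafVert, if_neg hd', hf, children_node, hd, if_true,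
        true_and, List.map_eq_nil_iff, List.length_map] at h₂ h₂' h₃' ⊢
      refine ⟨P' + P, E' + E, by omega, by omega, ?_⟩
      rw [h₃']
      ring
    · have hd' : Even (d + 1) := by simpa [Nat.even_add_one] using hd
      -- The word of an odd vertex is constant, so only even vertices contribute to `cdes`.
      have hc : cdesVert d (node a ts) = 0 :=
        wordCdes_eq_zero (by simpa using hs.1 (Nat.not_even_iff_odd.1 hd))
      simp only [hc, dcdesVert, eleafVert, if_pos hd', hd, false_and, if_false,
        zero_add] at h₂ ⊢
      exact ⟨P, E, by omega, by omega, by ring⟩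

end Monomial

/-! ### Bounds for the statistics -/

theorem ne_nil_of_mem_insertionsList {B : OTree} {d : ℕ} {ts ts' : List OTree}
    (h : ts' ∈ insertionsList B d ts) : ts' ≠ [] := by
  rintro rfl
  cases ts with
  | nil => simp [mem_insertionsList_nil] at h
  | cons t ts => simp [mem_insertionsList_cons] at h

theorem sumVerts_eleafVert_block {m c d : ℕ} (hd : Odd d) :
    sumVerts eleafVert d (block m c) = c := by
  have hd' : Even (d + 1) := by simpa [Nat.even_add_one] using hd
  simp [block, sumVerts_node, eleafVert, Nat.not_even_iff_odd.2 hd, hd']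

theorem sum_eleafVert_le {m c d : ℕ} {ts ts' : List OTree}
    (ih : ∀ t ∈ ts, ∀ t' ∈ insertions (block m c) d t,
      sumVerts eleafVert d t' ≤ sumVerts eleafVert d t + c)
    (h : ts' ∈ insertionsList (block m c) d ts) :
    (ts'.map (sumVerts eleafVert d)).sum ≤ (ts.map (sumVerts eleafVert d)).sum + c := by
  induction ts generalizing ts' with
  | nil =>
    obtain ⟨hd, rfl⟩ := mem_insertionsList_nil.1 h
    simp [sumVerts_eleafVert_block hd]
  | cons t ts ihl =>
    rcases mem_insertionsList_cons.1 h with ⟨hd, rfl⟩ | ⟨t', ht', rfl⟩ | ⟨us, hus, rfl⟩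
    · simp only [List.map_cons, List.sum_cons, sumVerts_eleafVert_block hd]
      omega
    · have := ih t (by simp) t' ht'
      simp only [List.map_cons, List.sum_cons]
      omega
    · have := ihl (fun t ht => ih t (by simp [ht])) hus
      simp only [List.map_cons, List.sum_cons]
      omega

theorem sumVerts_eleafVert_le {m c d : ℕ} {T T' : OTree} (h : T' ∈ insertions (block m c) d T) :
    sumVerts eleafVert d T' ≤ sumVerts eleafVert d T + c := by
  induction T using induction_children generalizing d T' with
  | h a ts ih =>
    obtain ⟨ts', h', rfl⟩ := mem_insertions_node.1 h
    have := sum_eleafVert_le (fun t ht t' ht' => ih t ht ht') h'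
    have h₀ : eleafVert d (node a ts') = 0 := if_neg fun h => ne_nil_of_mem_insertionsList h' h.2
    rw [sumVerts_node, sumVerts_node, h₀]
    omega

/-- Each block adds at most `k i - 1` even leaves. The root is left out because it is itself an even
leaf when `n = 0`, where the bound would fail. -/
theorem sum_eleafVert_children_le {n : ℕ} {k : ℕ → ℕ} (hk : ∀ i ∈ Finset.Icc 1 n, 1 ≤ k i)
    {T : OTree} (hT : T ∈ incTrees (blockMultiset n k)) :
    (T.children.map (sumVerts eleafVert 1)).sum + n ≤ ∑ i ∈ Finset.Icc 1 n, k i := by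
  induction n generalizing T with
  | zero =>
    rw [incTrees_blockMultiset_zero, Set.mem_singleton_iff] at hT
    subst hT
    simp
  | succ n ih =>
    have hc : k (n + 1) = k (n + 1) - 1 + 1 := by
      have := hk (n + 1) (by simp)
      omega
    obtain ⟨T₀, h₀, h⟩ := (mem_incTrees_succ hc T).1 hT
    have h₁ := ih (fun i hi => hk i (by simp only [Finset.mem_Icc] at hi ⊢; omega)) h₀
    obtain ⟨a, ts⟩ := T₀
    obtain ⟨ts', h', rfl⟩ := mem_insertions_node.1 h
    have := sum_eleafVert_le (fun t _ t' ht' => sumVerts_eleafVert_le ht') h'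
    rw [Finset.sum_Icc_succ_top (by omega)]
    simp only [children_node, zero_add] at *
    omega

theorem children_ne_nil_of_mem_incTrees {n : ℕ} {k : ℕ → ℕ} (hn : 1 ≤ n)
    (hk : ∀ i ∈ Finset.Icc 1 n, 1 ≤ k i) {T : OTree} (hT : T ∈ incTrees (blockMultiset n k)) :
    T.children ≠ [] := by
  intro h
  obtain ⟨a, ts⟩ := T
  obtain rfl : ts = [] := h
  obtain ⟨h₁, h₂, -⟩ := mem_incTrees_blockMultiset.1 hT
  obtain rfl : a = 0 := h₂
  rw [labels_node, Multiset.cons_inj_right] at h₁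
  have h₂ := count_blockMultiset n k 1
  rw [← h₁, if_pos (by simpa using hn)] at h₂
  have := hk 1 (by simpa using hn)
  simp at h₂
  omega

theorem eleaf_le {n : ℕ} {k : ℕ → ℕ} (hn : 1 ≤ n) (hk : ∀ i ∈ Finset.Icc 1 n, 1 ≤ k i)
    {T : OTree} (hT : T ∈ incTrees (blockMultiset n k)) :
    T.eleaf + n ≤ ∑ i ∈ Finset.Icc 1 n, k i := by
  have h₁ := sum_eleafVert_children_le hk hT
  have h₂ := children_ne_nil_of_mem_incTrees hn hk hT
  obtain ⟨a, ts⟩ := T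
  rw [eleaf_eq_sumVerts, sumVerts_node, eleafVert, if_neg fun h => h₂ h.2, zero_add]
  exact h₁

theorem one_le_cdes {n : ℕ} {k : ℕ → ℕ} (hn : 1 ≤ n) (hk : ∀ i ∈ Finset.Icc 1 n, 1 ≤ k i)
    {T : OTree} (hT : T ∈ incTrees (blockMultiset n k)) : 1 ≤ T.cdes := by
  have hs := separated_of_mem_incTrees hk hT
  have h₂ := children_ne_nil_of_mem_incTrees hn hk hT
  obtain ⟨a, ts⟩ := T
  obtain ⟨hnd, hlt⟩ := (allVerts_node.1 hs).1.2 (by simp)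
  rw [cdes_eq_sumVerts, sumVerts_node]
  refine le_add_right (one_le_wordCdes (by simpa using hlt) ?_)
  simpa using h₂

end OTree

-- Specialization and collection of coefficients.

open OTree MvPolynomial

theorem stirlingPoly_eq_sum {n : ℕ} {k : ℕ → ℕ} (hk : ∀ i ∈ Finset.Icc 1 n, 1 ≤ k i) :
    stirlingPoly (blockMultiset n k) =
      ∑ T ∈ (incTrees_finite (blockMultiset n k)).toFinset with T.dcdes = 0,
        X 2 ^ T.eleaf * ((X 0 * X 1) ^ T.cdes *
          (X 0 + X 1) ^ ((∑ i ∈ Finset.Icc 1 n, k i) + 1 - T.eleaf - 2 * T.cdes)) := by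
  have h := sum_wordWt_eq_sum_wt (R := MvPolynomial (Fin 4) ℤ)
    (mkDerivation ℤ fun _ => X 0 * X 1) (x := X 0) (y := X 1) (z := X 2) (q := X 3)
    (mkDerivation_X ..) (mkDerivation_X ..) (mkDerivation_X ..) (mkDerivation_X ..) n k hk
  -- Substitute q = x + y, so that r = x + y - q becomes 0.
  apply_fun aeval (R := ℤ) (![X 0, X 1, X 2, X 0 + X 1] : Fin 4 → MvPolynomial (Fin 3) ℤ) at h
  rw [map_sum, map_sum] at h
  rw [stirlingPoly, Finset.sum_filter]
  convert h using 1
  · exact Finset.sum_congr rfl fun w _ => by simp [wordWt_zero]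
  · refine Finset.sum_congr rfl fun T hT => ?_
    rw [Set.Finite.mem_toFinset] at hT
    obtain ⟨P, E, h₁, h₂, h₃⟩ := wt_eq (X 0 * X 1) (X 3) (X 0 + X 1 - X 3)
      (X 2 : MvPolynomial (Fin 4) ℤ) (separated_of_mem_incTrees hk hT)
    rw [← dcdes_eq_sumVerts, ← cdes_eq_sumVerts] at h₁
    rw [← dcdes_eq_sumVerts, ← eleaf_eq_sumVerts, (mem_incTrees_blockMultiset.1 hT).1,
      Multiset.card_cons, card_blockMultiset, if_pos (by simp)] at h₂
    rw [h₃, ← dcdes_eq_sumVerts, ← eleaf_eq_sumVerts]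
    split_ifs with h₀
    · rw [h₀] at h₁ h₂ ⊢
      rw [← h₁, show (∑ i ∈ Finset.Icc 1 n, k i) + 1 - T.eleaf - 2 * (P + 0) = E by omega]
      simp
      ring
    -- A positive power of r = 0 kills the term.
    · simp [h₀]

theorem gammaIT_eq_card (M : Multiset ℕ) (i j : ℕ) :
    gammaIT M i j = ((incTrees_finite M).toFinset.filter fun T =>
      T.dcdes = 0 ∧ T.eleaf = i ∧ T.cdes = j).card := by
  rw [gammaIT, ← Set.ncard_coe_finset]
  congr 1
  ext T
  simp only [Set.mem_ofPred_eq, Finset.coe_filter, Set.Finite.mem_toFinset]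
  tauto

theorem stirlingPoly_eq_sum_gammaIT {n : ℕ} (hn : 1 ≤ n) {k : ℕ → ℕ}
    (hk : ∀ i ∈ Finset.Icc 1 n, 1 ≤ k i) {K : ℕ} (hK : K = ∑ i ∈ Finset.Icc 1 n, k i) :
    stirlingPoly (blockMultiset n k) =
      ∑ i ∈ Finset.range (K - n + 1), X 2 ^ i *
        ∑ j ∈ Finset.Icc 1 ((K + 1 - i) / 2),
          (gammaIT (blockMultiset n k) i j : MvPolynomial (Fin 3) ℤ) *
            (X 0 * X 1) ^ j * (X 0 + X 1) ^ (K + 1 - i - 2 * j) := by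
  rw [stirlingPoly_eq_sum hk, ← hK, ← Finset.sum_fiberwise_of_maps_to
    (g := eleaf) (t := Finset.range (K - n + 1))]
  · refine Finset.sum_congr rfl fun i _ => ?_
    rw [← Finset.sum_fiberwise_of_maps_to (g := cdes) (t := Finset.Icc 1 ((K + 1 - i) / 2)),
      Finset.mul_sum]
    · refine Finset.sum_congr rfl fun j _ => ?_
      rw [gammaIT_eq_card, Finset.filter_filter, Finset.filter_filter]
      rw [mul_assoc, mul_left_comm, ← nsmul_eq_mul, ← Finset.sum_const]
      refine Finset.sum_congr rfl fun T hT => ?_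
      obtain ⟨-, -, h₁, h₂⟩ := Finset.mem_filter.1 hT
      rw [h₁, h₂]
    · intro T hT
      simp only [Finset.mem_filter, Set.Finite.mem_toFinset] at hT
      obtain ⟨⟨hT, h₀⟩, rfl⟩ := hT
      -- Only the relations between the exponents are needed, so the weights are arbitrary.
      obtain ⟨P, E, h₁, h₂, -⟩ := wt_eq (0 : ℤ) 0 0 0 (separated_of_mem_incTrees hk hT)
      rw [← dcdes_eq_sumVerts, ← cdes_eq_sumVerts] at h₁
      rw [← dcdes_eq_sumVerts, ← eleaf_eq_sumVerts, (mem_incTrees_blockMultiset.1 hT).1,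
        Multiset.card_cons, card_blockMultiset, if_pos (by simp), ← hK] at h₂
      have := one_le_cdes hn hk hT
      rw [Finset.mem_Icc]
      omega
  · intro T hT
    simp only [Finset.mem_filter, Set.Finite.mem_toFinset] at hT
    have := eleaf_le hn hk hT.1
    rw [Finset.mem_range]
    omega

theorem partialGammaPositive_sum (N : ℕ) (d : ℕ → ℕ) (γ : ℕ → ℕ → ℕ) :
    PartialGammaPositive (∑ i ∈ Finset.range N, X 2 ^ i * ∑ j ∈ Finset.Icc 1 (d i / 2),
      (γ i j : MvPolynomial (Fin 3) ℤ) * (X 0 * X 1) ^ j * (X 0 + X 1) ^ (d i - 2 * j)) := by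
  refine ⟨N, fun i => ∑ j ∈ Finset.Icc 1 (d i / 2),
    (γ i j : MvPolynomial (Fin 2) ℤ) * (X 0 * X 1) ^ j * (X 0 + X 1) ^ (d i - 2 * j),
    -- The definition sums from index 0, the expansion from 1; the missing coefficient is 0.
    fun i => ⟨d i, fun j => if j = 0 then 0 else γ i j, fun j => ?_, ?_⟩, ?_⟩
  · dsimp only
    split_ifs <;> simp
  · dsimp only
    rw [Finset.sum_range_succ', if_pos rfl, Finset.range_eq_Ico, Finset.sum_Ico_add'
      (fun j => C (if j = 0 then 0 else (γ i j : ℤ)) * (X 0 * X 1) ^ j *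
        (X 0 + X 1) ^ (d i - 2 * j))]
    simp only [map_zero, zero_mul, add_zero]
    refine Finset.sum_congr (by ext; simp) fun j hj => ?_
    have := (Finset.mem_Icc.1 hj).1
    rw [if_neg (by omega)]
    simp
  · refine Finset.sum_congr rfl fun i _ => ?_
    rw [mul_comm, map_sum]
    congr 1
    refine Finset.sum_congr rfl fun j _ => ?_
    simp

end GammaPos

theorem theorem4 (n : ℕ) (hn : 1 ≤ n) (k : ℕ → ℕ) (hk : ∀ i ∈ Finset.Icc 1 n, 1 ≤ k i)
    (K : ℕ) (hK : K = ∑ i ∈ Finset.Icc 1 n, k i) :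
    GammaPos.PartialGammaPositive (GammaPos.stirlingPoly (GammaPos.blockMultiset n k)) ∧
    GammaPos.stirlingPoly (GammaPos.blockMultiset n k) =
      ∑ i ∈ Finset.range (K - n + 1), MvPolynomial.X 2 ^ i *
        ∑ j ∈ Finset.Icc 1 ((K + 1 - i) / 2),
          (GammaPos.gammaIT (GammaPos.blockMultiset n k) i j : MvPolynomial (Fin 3) ℤ) *
            (MvPolynomial.X 0 * MvPolynomial.X 1) ^ j *
            (MvPolynomial.X 0 + MvPolynomial.X 1) ^ (K + 1 - i - 2 * j) := by
  have h := GammaPos.stirlingPoly_eq_sum_gammaIT hn hk hK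
  exact ⟨h ▸ GammaPos.partialGammaPositive_sum _ (fun i => K + 1 - i) _, h⟩
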